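/- Let $\mathcal R=\{(d,m)\in\mathbb R^3\times\mathbb R^3:\|d\|=1,\ \langle d,m\rangle=0\}$ be the space of oriented lines (rays) in Plücker coordinates: $d$ is the direction and $m=p\times d$ the moment, $p$ being any point of the line. The group $SE(3)$ acts by $(R,t)(d,m)=(Rd,\,Rm+t\times Rd)$ on $\mathcal R$ and by $(R,t)v=Rv+t$ on $\mathbb R^3$; $R\in SO(3)$ is identified with $(R,0)$. Let $dy=d\sigma(d)\,dm$ be the $SE(3)$-invariant measure on $\mathcal R$ ($\sigma$ the area on the unit sphere, $dm$ the area on the plane $d^\perp$), and let $s(x)=(I,x)$ for $x\in\mathbb R^3$. Let $l\ge 0$. The space of homogeneous harmonic real polynomials of degree $l$ in three variables (whose restrictions to the unit sphere are the spherical harmonics of degree $l$) has dimension $2l+1$. Fix any basis $Y_1,\dots,Y_{2l+1}$ of it, write $Y^l(d)=(Y_1(d),\dots,Y_{2l+1}(d))^T$, and let $\rho_{out}(R)$ be the $(2l+1)\times(2l+1)$ matrix with $Y^l(Rd)=\rho_{out}(R)\,Y^l(d)$ for all $d$ (the type-$l$, or Wigner, representation of $SO(3)$ in this basis). This $\rho_{out}$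 is an irreducible representation of $SO(3)$ on $\mathbb R^{2l+1}$. For a kernel $\kappa:\mathcal R\to\mathbb R^{2l+1}$ and a scalar field $f:\mathcal R\to\mathbb R$ put $$(\kappa*f)(x)=\int_{\mathcal R}\kappa(s(x)^{-1}y)\,f(y)\,dy .$$ The convolution with $\kappa$ is called equivariant if for every $f$ for which this integral converges absolutely at every $x\in\mathbb R^3$, and every $g=(R,t)\in SE(3)$, the same holds for $(L_gf)(y)=f(g^{-1}y)$, and $(\kappa*L_gf)(x)=\rho_{out}(R)\,(\kappa*f)(g^{-1}x)$ for all $x$. Then: (1) If $\kappa$ is locally integrable, the convolution with $\kappa$ is equivariant if and only if for every $R\in SO(3)$ one has $\kappa(Rx)=\rho_{out}(R)\kappa(x)$ for almost every $x\in\mathcal R$. If $\kappa$ is continuous, it is equivariant if and only if $\kappa(Rx)=\rho_{out}(R)\kappa(x)$ for all $R\in SO(3)$ and all $x\in\mathcal R$. (2) An arbitrary function $\kappa:\mathcal R\to\mathbb R^{2l+1}$ satisfies the constraint $\kappa(Rx)=\rho_{out}(R)\kappa(x)$ for all $R\in SO(3)$, $x\in\mathcal R$ if and only if there are a constant $c\in\mathbb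 R$ and a function $f:\mathbb R\to\mathbb R^{2l+1}$ such that for every $x=(d_x,m_x)\in\mathcal R$ $$\kappa(x)=c\,Y^l(d_x)\ \text{ if } m_x=0,\qquad \kappa(x)=\rho_{out}(\hat x)\,f(\|m_x\|)\ \text{ if } m_x\neq0,$$ where $\hat x\in SO(3)$ is the matrix with columns $d_x,\ m_x/\|m_x\|,\ d_x\times m_x/\|m_x\|$. (3) If $\kappa$ satisfies the constraint of (2) and $d_0\in\mathbb R$, then so does the kernel that equals $\kappa(x)$ where $\|m_x\|\le d_0$ and $0$ elsewhere. (4) (The case $d_0=0$.) For $x\in\mathbb R^3$ equip the set of rays through $x$ with the area measure $\sigma$ of their directions. If $\kappa(x)=c\,Y^l(d_x)$ whenever $m_x=0$, then for every $f$ and $x$ the convolution over the rays through $x$ of the kernel $\kappa$ cut off at $d_0=0$ as in (3) equals $$c\int_{\{y\,:\,y\text{ passes through }x\}}Y^l\big(d_{s(x)^{-1}y}\big)\,f(y)\,dy ,$$ and the convolution $f\mapsto\int_{\{y\,:\,y\text{ passes through }x\}}Y^l(d_{s(x)^{-1}y})f(y)\,dy$ is equivariant (in the above sense, with this integral in place of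 the one over $\mathcal R$). -/

import Mathlib

open MeasureTheory Matrix

noncomputable section

namespace RayConv

/-! ### Rotations, rigid motions, rays -/

/-- Euclidean three-space. -/
abbrev E3 : Type := EuclideanSpace ℝ (Fin 3)

/-- The rotation group `SO(3)`. -/
abbrev SO3 : Type := Matrix.specialOrthogonalGroup (Fin 3) ℝ

/-- The vector `R v`. -/
def rotate (R : SO3) (v : E3) : E3 := WithLp.toLp 2 (R.1 *ᵥ v.ofLp)

/-- The cross product on Euclidean three-space. -/
def cross (a b : E3) : E3 := WithLp.toLp 2 (crossProduct a.ofLp b.ofLp)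

theorem SO3.transpose_mul (R : SO3) : (R.1)ᵀ * R.1 = 1 := by
  have h := (Matrix.mem_orthogonalGroup_iff' (Fin 3) ℝ).1
    (Matrix.mem_specialOrthogonalGroup_iff.1 R.2).1
  exact h

theorem SO3.det_eq (R : SO3) : (R.1).det = 1 :=
  (Matrix.mem_specialOrthogonalGroup_iff.1 R.2).2

theorem inner_eq (a b : E3) : inner ℝ a b = a 0 * b 0 + a 1 * b 1 + a 2 * b 2 := by
  simp [PiLp.inner_apply, Fin.sum_univ_three, mul_comm]

theorem inner_eq_dot (a b : E3) : inner ℝ a b = a.ofLp ⬝ᵥ b.ofLp := by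
  simp [inner_eq, dotProduct, Fin.sum_univ_three]

theorem norm_eq_one_iff (a : E3) : ‖a‖ = 1 ↔ a 0 * a 0 + a 1 * a 1 + a 2 * a 2 = 1 := by
  rw [← inner_eq, real_inner_self_eq_norm_sq]
  constructor
  · intro h; rw [h]; norm_num
  · intro h; nlinarith [norm_nonneg a]

theorem inner_rotate (R : SO3) (a b : E3) :
    inner ℝ (rotate R a) (rotate R b) = inner ℝ a b := by
  rw [inner_eq_dot, inner_eq_dot]
  simp only [rotate]
  rw [Matrix.dotProduct_mulVec, Matrix.vecMul_mulVec, SO3.transpose_mul, Matrix.vecMul_one]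

theorem norm_rotate (R : SO3) (a : E3) : ‖rotate R a‖ = ‖a‖ := by
  rw [@norm_eq_sqrt_real_inner _ _ _ a, @norm_eq_sqrt_real_inner _ _ _ (rotate R a), inner_rotate]

theorem rotate_one (v : E3) : rotate 1 v = v := by simp [rotate]

theorem rotate_mul (R S : SO3) (v : E3) : rotate (R * S) v = rotate R (rotate S v) := by
  simp [rotate, Matrix.mulVec_mulVec]

theorem rotate_add (R : SO3) (v w : E3) : rotate R (v + w) = rotate R v + rotate R w := by
  simp [rotate, Matrix.mulVec_add]

theorem rotate_neg (R : SO3) (v : E3) : rotate R (-v) = -rotate R v := by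
  simp [rotate, Matrix.mulVec_neg]

theorem rotate_zero (R : SO3) : rotate R 0 = 0 := by
  simp [rotate]

theorem cross_add_left (a b c : E3) : cross (a + b) c = cross a c + cross b c := by
  simp [cross]

theorem cross_zero_left (a : E3) : cross 0 a = 0 := by
  simp [cross]

theorem inner_cross_self (a b : E3) : inner ℝ b (cross a b) = 0 := by
  rw [inner_eq_dot]; exact dot_cross_self _ _

theorem inner_self_cross (a b : E3) : inner ℝ a (cross a b) = 0 := by
  rw [inner_eq_dot]; exact dot_self_cross _ _

theorem rotate_cross (R : SO3) (a b : E3) :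
    rotate R (cross a b) = cross (rotate R a) (rotate R b) := by
  -- test against every `rotate R c`, using the triple product
  have hdet : ∀ u v w : Fin 3 → ℝ,
      (R.1 *ᵥ u) ⬝ᵥ crossProduct (R.1 *ᵥ v) (R.1 *ᵥ w) = u ⬝ᵥ crossProduct v w := by
    intro u v w
    rw [triple_product_eq_det, triple_product_eq_det]
    have : Matrix.of ![R.1 *ᵥ u, R.1 *ᵥ v, R.1 *ᵥ w]
        = Matrix.of ![u, v, w] * (R.1)ᵀ := by
      ext i j
      fin_cases i <;> simp [Matrix.mul_apply, Matrix.mulVec, dotProduct, mul_comm]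
    change Matrix.det (Matrix.of ![R.1 *ᵥ u, R.1 *ᵥ v, R.1 *ᵥ w]) = Matrix.det (Matrix.of ![u, v, w])
    rw [this, Matrix.det_mul, Matrix.det_transpose, SO3.det_eq, mul_one]
  refine ext_inner_left ℝ fun c => ?_
  have hc : c = rotate R (rotate R⁻¹ c) := by rw [← rotate_mul, mul_inv_cancel, rotate_one]
  rw [hc, inner_rotate, inner_eq_dot, inner_eq_dot]
  exact (hdet _ _ _).symm

/-- The group `SE(3)` of rigid motions `v ↦ R v + t`, written as pairs `(R, t)`. -/
@[ext] structure SE3 where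
  rot : SO3
  trans : E3

instance : Mul SE3 := ⟨fun g h => ⟨g.rot * h.rot, rotate g.rot h.trans + g.trans⟩⟩
instance : One SE3 := ⟨⟨1, 0⟩⟩
instance : Inv SE3 := ⟨fun g => ⟨g.rot⁻¹, -rotate g.rot⁻¹ g.trans⟩⟩

@[simp] theorem SE3.mul_rot (g h : SE3) : (g * h).rot = g.rot * h.rot := rfl
@[simp] theorem SE3.mul_trans (g h : SE3) :
    (g * h).trans = rotate g.rot h.trans + g.trans := rfl
@[simp] theorem SE3.one_rot : (1 : SE3).rot = 1 := rfl
@[simp] theorem SE3.one_trans : (1 : SE3).trans = 0 := rfl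
@[simp] theorem SE3.inv_rot (g : SE3) : (g⁻¹).rot = g.rot⁻¹ := rfl
@[simp] theorem SE3.inv_trans (g : SE3) : (g⁻¹).trans = -rotate g.rot⁻¹ g.trans := rfl

instance : Group SE3 :=
  Group.ofLeftAxioms
    (fun a b c => by
      ext1
      · simp [mul_assoc]
      · simp [rotate_mul, rotate_add, add_assoc])
    (fun a => by ext1 <;> simp [rotate_one])
    (fun a => by ext1 <;> simp)

/-- `SE(3)` acts on space by `(R, t) v = R v + t`. -/
instance : MulAction SE3 E3 where
  smul g v := rotate g.rot v + g.trans
  one_smul v := by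
    change rotate 1 v + 0 = v
    rw [rotate_one, add_zero]
  mul_smul g h v := by
    change rotate (g.rot * h.rot) v + (rotate g.rot h.trans + g.trans)
      = rotate g.rot (rotate h.rot v + h.trans) + g.trans
    rw [rotate_mul, rotate_add, add_assoc]

/-- The ray space: oriented lines in Plücker coordinates `(d, m)`, with `d` a unit direction and
`m = p × d` the moment, `p` being any point of the line. The pairs so obtained are those with
`‖d‖ = 1` and `⟪d, m⟫ = 0`. -/
def Ray : Type := {x : E3 × E3 // ‖x.1‖ = 1 ∧ inner ℝ x.1 x.2 = 0}

instance : TopologicalSpace Ray := instTopologicalSpaceSubtype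
instance : MeasurableSpace Ray := Subtype.instMeasurableSpace
instance : BorelSpace Ray := Subtype.borelSpace _

/-- The direction `d` of a ray. -/
def Ray.dir (x : Ray) : E3 := x.1.1

/-- The moment `m` of a ray. -/
def Ray.moment (x : Ray) : E3 := x.1.2

theorem Ray.norm_dir (x : Ray) : ‖x.dir‖ = 1 := x.2.1

theorem Ray.inner_dir_moment (x : Ray) : inner ℝ x.dir x.moment = 0 := x.2.2

/-- `SE(3)` acts on rays by `(R, t) (d, m) = (R d, R m + t × (R d))`. -/
instance : MulAction SE3 Ray where
  smul g x := ⟨(rotate g.rot x.dir, rotate g.rot x.moment + cross g.trans (rotate g.rot x.dir)), by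
    refine ⟨by simpa [norm_rotate] using x.norm_dir, ?_⟩
    simp only [inner_add_right, inner_rotate, inner_cross_self, x.inner_dir_moment, add_zero]⟩
  one_smul x := by
    refine Subtype.ext (Prod.ext ?_ ?_)
    · exact rotate_one _
    · change rotate 1 x.moment + cross 0 _ = x.moment
      rw [rotate_one, cross_zero_left, add_zero]
  mul_smul g h x := by
    refine Subtype.ext (Prod.ext ?_ ?_)
    · exact rotate_mul _ _ _
    · change rotate (g.rot * h.rot) x.moment +
          cross (rotate g.rot h.trans + g.trans) (rotate (g.rot * h.rot) x.dir)
        = rotate g.rot (rotate h.rot x.moment + cross h.trans (rotate h.rot x.dir)) +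
          cross g.trans (rotate g.rot (rotate h.rot x.dir))
      rw [rotate_mul, rotate_mul, rotate_add, rotate_cross, cross_add_left, add_assoc]

/-- The stabilizer `SO(3)` of the origin, as rigid motions. -/
def ofRot (R : SO3) : SE3 := ⟨R, 0⟩

/-- The ray through the point `p` with direction `d`. -/
def rayThrough (p : E3) (d : Metric.sphere (0 : E3) 1) : Ray :=
  ⟨(d.1, cross p d.1), mem_sphere_zero_iff_norm.1 d.2, inner_cross_self _ _⟩

/-! ### Spherical harmonics and the irreducible representation of type `l` -/

/-- The Laplacian `∂₁² + ∂₂² + ∂₃²` on real polynomials in three variables. -/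
def laplacian : MvPolynomial (Fin 3) ℝ →ₗ[ℝ] MvPolynomial (Fin 3) ℝ :=
  ∑ i, (MvPolynomial.pderiv i).toLinearMap ∘ₗ (MvPolynomial.pderiv i).toLinearMap

/-- The homogeneous harmonic polynomials of degree `l`. Their values on the unit sphere are the
(real) spherical harmonics of degree `l`. -/
def Harmonics (l : ℕ) : Submodule ℝ (MvPolynomial (Fin 3) ℝ) :=
  MvPolynomial.homogeneousSubmodule (Fin 3) ℝ l ⊓ LinearMap.ker laplacian

/-- The polynomial `v ↦ p (R v)`. -/
def compRot (R : SO3) : MvPolynomial (Fin 3) ℝ →ₐ[ℝ] MvPolynomial (Fin 3) ℝ :=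
  MvPolynomial.aeval fun i => ∑ j, MvPolynomial.C (R.1 i j) * MvPolynomial.X j

theorem eval_compRot (R : SO3) (p : MvPolynomial (Fin 3) ℝ) (v : E3) :
    MvPolynomial.eval v.ofLp (compRot R p) = MvPolynomial.eval (rotate R v).ofLp p := by
  induction p using MvPolynomial.induction_on with
  | C a => simp [compRot]
  | add p q hp hq => simp [hp, hq]
  | mul_X p i hp =>
    rw [map_mul, map_mul, map_mul, hp]
    congr 1
    simp [compRot, rotate, Matrix.mulVec, dotProduct]

theorem compRot_one (p : MvPolynomial (Fin 3) ℝ) : compRot 1 p = p := by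
  refine MvPolynomial.funext fun v => ?_
  have := eval_compRot 1 p (WithLp.toLp 2 v)
  rwa [rotate_one] at this

theorem compRot_mul (R S : SO3) (p : MvPolynomial (Fin 3) ℝ) :
    compRot (R * S) p = compRot S (compRot R p) := by
  refine MvPolynomial.funext fun v => ?_
  have h1 := eval_compRot (R * S) p (WithLp.toLp 2 v)
  have h2 := eval_compRot S (compRot R p) (WithLp.toLp 2 v)
  rw [eval_compRot R p, ← rotate_mul] at h2
  exact h1.trans h2.symm

theorem pderiv_compRot (R : SO3) (k : Fin 3) (p : MvPolynomial (Fin 3) ℝ) :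
    MvPolynomial.pderiv k (compRot R p)
      = ∑ i, R.1 i k • compRot R (MvPolynomial.pderiv i p) := by
  induction p using MvPolynomial.induction_on with
  | C a => simp [compRot]
  | add p q hp hq => simp [hp, hq, Finset.sum_add_distrib]
  | mul_X p j hp =>
    have hX : MvPolynomial.pderiv k (compRot R (MvPolynomial.X j)) = MvPolynomial.C (R.1 j k) := by
      simp [compRot, MvPolynomial.pderiv_X, Pi.single_apply]
    rw [map_mul, MvPolynomial.pderiv_mul, hp, hX]
    simp only [MvPolynomial.pderiv_mul, map_add, map_mul, MvPolynomial.pderiv_X, smul_add,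
      Finset.sum_add_distrib, Finset.sum_mul, smul_mul_assoc]
    congr 1
    rw [Finset.sum_eq_single j]
    · simp [MvPolynomial.smul_eq_C_mul, mul_comm]
    · intro i _ hij
      simp [hij.symm]
    · simp

theorem laplacian_compRot (R : SO3) (p : MvPolynomial (Fin 3) ℝ) :
    laplacian (compRot R p) = compRot R (laplacian p) := by
  have horth : ∀ i j : Fin 3, ∑ k, R.1 i k * R.1 j k = if i = j then 1 else 0 := by
    intro i j
    have h : R.1 * (R.1)ᵀ = 1 := mul_eq_one_comm.1 (SO3.transpose_mul R)
    have := congrFun (congrFun h i) j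
    simpa [Matrix.mul_apply, Matrix.one_apply] using this
  have h2 : ∀ k : Fin 3, MvPolynomial.pderiv k (MvPolynomial.pderiv k (compRot R p))
      = ∑ i, ∑ j, (R.1 i k * R.1 j k) •
          compRot R (MvPolynomial.pderiv j (MvPolynomial.pderiv i p)) := by
    intro k
    simp only [pderiv_compRot, map_sum, Derivation.map_smul, Finset.smul_sum, smul_smul]
  have : laplacian (compRot R p)
      = ∑ k, MvPolynomial.pderiv k (MvPolynomial.pderiv k (compRot R p)) := by
    simp [laplacian, LinearMap.sum_apply]
  have h3 : ∀ i : Fin 3, (∑ k, ∑ j, (R.1 i k * R.1 j k) •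
      compRot R (MvPolynomial.pderiv j (MvPolynomial.pderiv i p)))
      = compRot R (MvPolynomial.pderiv i (MvPolynomial.pderiv i p)) := by
    intro i
    rw [Finset.sum_comm]
    simp only [← Finset.sum_smul, horth]
    simp
  rw [this]
  simp only [h2]
  rw [Finset.sum_comm, Finset.sum_congr rfl fun i _ => h3 i]
  simp [laplacian, LinearMap.sum_apply]

theorem compRot_mem (R : SO3) {l : ℕ} {p : MvPolynomial (Fin 3) ℝ} (hp : p ∈ Harmonics l) :
    compRot R p ∈ Harmonics l := by
  refine ⟨?_, ?_⟩
  · have h : p.IsHomogeneous l := hp.1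
    have := h.aeval (fun i => ∑ j, MvPolynomial.C (R.1 i j) * MvPolynomial.X (R := ℝ) j)
      (n := 1) (fun i => MvPolynomial.IsHomogeneous.sum _ _ _ fun j _ => by
        simpa using (MvPolynomial.isHomogeneous_C (Fin 3) (R.1 i j)).mul
          (MvPolynomial.isHomogeneous_X ℝ j))
    rw [one_mul] at this
    exact this
  · have h : laplacian p = 0 := hp.2
    change laplacian (compRot R p) = 0
    rw [laplacian_compRot, h, map_zero]

/-- The linear map `p ↦ p ∘ R` on homogeneous harmonic polynomials of degree `l`. -/
def compRotH (l : ℕ) (R : SO3) : Harmonics l →ₗ[ℝ] Harmonics l :=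
  (compRot R).toLinearMap.restrict fun _ hp => compRot_mem R hp

/-- For `Y` a basis of the spherical harmonics of degree `l`, the column vector
`Y(d) = (Y_0(d), …, Y_{2l}(d))`. -/
def sphHarm {l : ℕ} (Y : Module.Basis (Fin (2 * l + 1)) ℝ (Harmonics l)) (d : E3) :
    Fin (2 * l + 1) → ℝ :=
  fun i => MvPolynomial.eval d.ofLp (Y i).1

/-- The representation of `SO(3)` of type `l` in the basis `Y` (the Wigner matrices): `ρ(R)` is
the matrix with `Y_i(R d) = ∑ j, ρ(R)_{ij} Y_j(d)`. -/
def wigner {l : ℕ} (Y : Module.Basis (Fin (2 * l + 1)) ℝ (Harmonics l)) :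
    Representation ℝ SO3 (Fin (2 * l + 1) → ℝ) where
  toFun R := Matrix.toLin' (LinearMap.toMatrix Y Y (compRotH l R))ᵀ
  map_one' := by
    have : compRotH l 1 = LinearMap.id :=
      LinearMap.ext fun p => Subtype.ext (compRot_one p.1)
    rw [this, LinearMap.toMatrix_id, Matrix.transpose_one, Matrix.toLin'_one]
    rfl
  map_mul' R S := by
    have : compRotH l (R * S) = compRotH l S ∘ₗ compRotH l R :=
      LinearMap.ext fun p => Subtype.ext (compRot_mul R S p.1)
    rw [this, LinearMap.toMatrix_comp Y Y Y, Matrix.transpose_mul, Matrix.toLin'_mul]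
    rfl

theorem sphHarm_rotate {l : ℕ} (Y : Module.Basis (Fin (2 * l + 1)) ℝ (Harmonics l))
    (R : SO3) (d : E3) : sphHarm Y (rotate R d) = wigner Y R (sphHarm Y d) := by
  funext i
  have h : compRotH l R (Y i) = ∑ j, (Y.repr (compRotH l R (Y i)) j) • Y j :=
    (Y.sum_repr _).symm
  have h' : compRot R (Y i).1 = ∑ j, (Y.repr (compRotH l R (Y i)) j) • (Y j).1 := by
    have h2 := congrArg (Harmonics l).subtype h
    rw [map_sum] at h2
    exact h2
  simp only [sphHarm]
  rw [← eval_compRot, h']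
  simp [wigner, sphHarm, Matrix.mulVec, dotProduct, LinearMap.toMatrix_apply,
    MvPolynomial.smul_eval]

/-! ### The frame of a ray that misses the origin -/

/-- The matrix with columns `d`, `m / ‖m‖`, `d × (m / ‖m‖)`. -/
def frameMatrix (x : Ray) : Matrix (Fin 3) (Fin 3) ℝ :=
  (Matrix.of ![x.dir.ofLp, (‖x.moment‖⁻¹ • x.moment).ofLp,
    (cross x.dir (‖x.moment‖⁻¹ • x.moment)).ofLp])ᵀ

theorem frameMatrix_mem (x : Ray) (hx : x.moment ≠ 0) :
    frameMatrix x ∈ Matrix.specialOrthogonalGroup (Fin 3) ℝ := by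
  set d : E3 := x.dir with hd
  set n : E3 := ‖x.moment‖⁻¹ • x.moment with hn
  have h1 : d 0 * d 0 + d 1 * d 1 + d 2 * d 2 = 1 := (norm_eq_one_iff _).1 x.norm_dir
  have h2 : n 0 * n 0 + n 1 * n 1 + n 2 * n 2 = 1 := by
    refine (norm_eq_one_iff _).1 ?_
    rw [hn, norm_smul, norm_inv, norm_norm, inv_mul_cancel₀ (norm_ne_zero_iff.2 hx)]
  have h3 : d 0 * n 0 + d 1 * n 1 + d 2 * n 2 = 0 := by
    rw [← inner_eq, hn, inner_smul_right, hd, x.inner_dir_moment, mul_zero]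
  have hM : frameMatrix x = !![d 0, n 0, d 1 * n 2 - d 2 * n 1;
      d 1, n 1, d 2 * n 0 - d 0 * n 2; d 2, n 2, d 0 * n 1 - d 1 * n 0] := by
    ext i j
    fin_cases i <;> fin_cases j <;> simp [frameMatrix, cross, cross_apply, ← hd, ← hn]
  have h4 : (d 1 * n 2 - d 2 * n 1) ^ 2 + (d 2 * n 0 - d 0 * n 2) ^ 2
      + (d 0 * n 1 - d 1 * n 0) ^ 2 = 1 := by
    have : (d 1 * n 2 - d 2 * n 1) ^ 2 + (d 2 * n 0 - d 0 * n 2) ^ 2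
      + (d 0 * n 1 - d 1 * n 0) ^ 2 = (d 0 * d 0 + d 1 * d 1 + d 2 * d 2) *
        (n 0 * n 0 + n 1 * n 1 + n 2 * n 2) - (d 0 * n 0 + d 1 * n 1 + d 2 * n 2) ^ 2 := by ring
    rw [this, h1, h2, h3]; norm_num
  refine Matrix.mem_specialOrthogonalGroup_iff.2 ⟨?_, ?_⟩
  · refine (Matrix.mem_orthogonalGroup_iff' (Fin 3) ℝ).2 ?_
    change (frameMatrix x)ᵀ * frameMatrix x = 1
    rw [hM]
    ext i j
    fin_cases i <;> fin_cases j <;>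
      simp [Matrix.mul_apply, Fin.sum_univ_three] <;> linarith
  · rw [hM, Matrix.det_fin_three]
    simp
    linarith

/-- The rotation `x̂ = (d, m / ‖m‖, d × (m / ‖m‖))` attached to a ray with nonzero moment. -/
def frame (x : Ray) (hx : x.moment ≠ 0) : SO3 := ⟨frameMatrix x, frameMatrix_mem x hx⟩

/-! ### The convolution from rays to points -/

/-- The `SE(3)`-invariant measure `dσ(d) dm` on the ray space (`σ` the area of the sphere, `dm`
the area of the plane `d^⊥`). It is written as the image of the product measure on pairs
`(d, p)` with `0 ≤ ⟪p, d⟫ ≤ 1` under `(d, p) ↦ (d, p × d)`: the points `p` of a given line that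
satisfy the bound form a segment of length `1`. -/
def rayMeasure : Measure Ray :=
  Measure.map (fun q : Metric.sphere (0 : E3) 1 × E3 => rayThrough q.2 q.1)
    (((volume : Measure E3).toSphere.prod volume).restrict
      {q | inner ℝ q.2 q.1.1 ∈ Set.Icc (0 : ℝ) 1})

/-- The measure on the rays through the point `x` given by the area `σ` of the sphere of
directions. -/
def pencilMeasure (x : E3) : Measure Ray :=
  Measure.map (rayThrough x) (volume : Measure E3).toSphere

/-- The section `x ↦ (I, x)` of `SE(3) → ℝ³`. -/
def sec (x : E3) : SE3 := ⟨1, x⟩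

/-- The twist `h(g, x) = s(g x)⁻¹ g s(x)`, an element of the stabilizer `SO(3)` of the origin. -/
def twist (g : SE3) (x : E3) : SO3 := ((sec (g • x))⁻¹ * g * sec x).rot

/-- The action of `SE(3)` on scalar fields over the ray space. -/
def actIn (g : SE3) (f : Ray → ℝ) : Ray → ℝ := fun y => f (g⁻¹ • y)

/-- The action of `SE(3)` on fields over `ℝ³` whose type is the representation `ρ` of `SO(3)`. -/
def actOut {V : Type*} [AddCommGroup V] [Module ℝ V] (ρ : Representation ℝ SO3 V)
    (g : SE3) (F : E3 → V) : E3 → V :=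
  fun x => ρ (twist g⁻¹ x)⁻¹ (F (g⁻¹ • x))

/-- The convolution `(κ * f)(x) = ∫ κ(s(x)⁻¹ y) f(y) dν_x(y)` of a scalar field on rays. The
measure is `rayMeasure` for the convolution over all rays, and `pencilMeasure x` for the
convolution over the rays through `x`. -/
def conv {n : ℕ} (ν : E3 → Measure Ray) (κ : Ray → Fin n → ℝ) (f : Ray → ℝ) (x : E3) :
    Fin n → ℝ :=
  ∫ y, f y • κ ((sec x)⁻¹ • y) ∂(ν x)

/-- `κ * f` is defined: the integral converges at every point. -/
def ConvDefined {n : ℕ} (ν : E3 → Measure Ray) (κ : Ray → Fin n → ℝ) (f : Ray → ℝ) : Prop :=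
  ∀ x, Integrable (fun y => f y • κ ((sec x)⁻¹ • y)) (ν x)

/-- The convolution with `κ` is `SE(3)`-equivariant: `κ * (L_g f) = L_g (κ * f)`. -/
def ConvEquivariant {n : ℕ} (ρ : Representation ℝ SO3 (Fin n → ℝ)) (ν : E3 → Measure Ray)
    (κ : Ray → Fin n → ℝ) : Prop :=
  ∀ f : Ray → ℝ, ConvDefined ν κ f →
    ∀ g : SE3, ConvDefined ν κ (actIn g f) ∧ conv ν κ (actIn g f) = actOut ρ g (conv ν κ f)

/-- The kernel constraint `κ(R x) = ρ(R) κ(x)`. -/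
def KernelConstraint {n : ℕ} (ρ : Representation ℝ SO3 (Fin n → ℝ)) (κ : Ray → Fin n → ℝ) :
    Prop :=
  ∀ (R : SO3) (x : Ray), κ (ofRot R • x) = ρ R (κ x)

open Classical in
/-- The kernel `κ` cut off outside `‖m‖ ≤ d₀`. -/
def truncate {n : ℕ} (d₀ : ℝ) (κ : Ray → Fin n → ℝ) : Ray → Fin n → ℝ :=
  fun x => if ‖x.moment‖ ≤ d₀ then κ x else 0

end RayConv

end

noncomputable section

namespace RayConv

/-! ### Rotations as isometries -/

/-! Equivariance rests on s(x)⁻¹ g = R s(g⁻¹ x)⁻¹ (`inv_sec_mul`). As the measures are carried along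
by `g`, the substitution y = g z reduces equivariance to the kernel constraint under the integral.
Conversely, testing at x = 0 on indicators of compact sets K gives ∫_K (κ(R y) - ρ(R) κ(y)) dy = 0
for every K. So the constraint holds almost everywhere, and everywhere if κ is continuous, because
nonempty open sets have positive measure.

The constraint is solved orbit by orbit. A ray off the origin is carried by exactly one rotation,
its frame, from a standard ray with the same ‖m‖, so the value on the standard ray is free. The rays
through the origin form one orbit, and the value on the axis must be fixed by the rotations about
it.

To find these fixed vectors, identify ℝ^(2l+1) with the dual of the harmonic polynomials, Y(d)
becoming evaluation at d. Let L = x ∂_y - y ∂_x. Every L p vanishes at the axis, and a harmonic p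
with L p = 0 that vanishes at the axis is zero (`eq_zero_of_infRot_eq_zero`). Hence L is bijective
on the hyperplane of harmonic polynomials vanishing at the axis. An invariant functional kills the
image of L, so it is a multiple of evaluation at the axis.

The same two facts give irreducibility: every nonzero invariant subspace contains a nonzero solution
of L p = 0, and these form a line, so a subspace and its orthogonal complement cannot both be
nonzero. -/

theorem rotate_smul (R : SO3) (a : ℝ) (v : E3) : rotate R (a • v) = a • rotate R v := by
  simp [rotate, Matrix.mulVec_smul]

theorem rotate_inv_rotate (R : SO3) (v : E3) : rotate R⁻¹ (rotate R v) = v := by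
  rw [← rotate_mul, inv_mul_cancel, rotate_one]

theorem rotate_rotate_inv (R : SO3) (v : E3) : rotate R (rotate R⁻¹ v) = v := by
  rw [← rotate_mul, mul_inv_cancel, rotate_one]

/-- A rotation as a linear isometry. -/
def rotateIso (R : SO3) : E3 ≃ₗᵢ[ℝ] E3 where
  toFun := rotate R
  map_add' := rotate_add R
  map_smul' := rotate_smul R
  invFun := rotate R⁻¹
  left_inv := rotate_inv_rotate R
  right_inv := rotate_rotate_inv R
  norm_map' := norm_rotate R

@[fun_prop] theorem continuous_rotate (R : SO3) : Continuous (rotate R) :=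
  (rotateIso R).continuous

@[fun_prop] theorem Continuous.cross {X : Type*} [TopologicalSpace X] {f g : X → E3}
    (hf : Continuous f) (hg : Continuous g) : Continuous fun x => cross (f x) (g x) := by
  refine (PiLp.continuous_toLp 2 _).comp ?_
  have hf' : ∀ i, Continuous fun x => (f x).ofLp i := fun i => by fun_prop
  have hg' : ∀ i, Continuous fun x => (g x).ofLp i := fun i => by fun_prop
  simp only [cross_apply]
  refine continuous_pi fun i => ?_
  fin_cases i
  · exact ((hf' 1).mul (hg' 2)).sub ((hf' 2).mul (hg' 1))
  · exact ((hf' 2).mul (hg' 0)).sub ((hf' 0).mul (hg' 2))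
  · exact ((hf' 0).mul (hg' 1)).sub ((hf' 1).mul (hg' 0))

theorem measurePreserving_rotate (R : SO3) :
    MeasurePreserving (rotate R) (volume : Measure E3) volume :=
  (rotateIso R).measurePreserving

/-- The action of a rotation on the unit sphere. -/
def rotateSphere (R : SO3) (d : Metric.sphere (0 : E3) 1) : Metric.sphere (0 : E3) 1 :=
  ⟨rotate R d.1, by simp [norm_rotate]⟩

@[fun_prop] theorem continuous_rotateSphere (R : SO3) : Continuous (rotateSphere R) :=
  Continuous.subtype_mk (by fun_prop) _

open scoped Pointwise in
-- `toSphere` gives a set of directions three times the volume of the cone over it, and the cone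
-- over a rotated set is the rotated cone.
theorem measurePreserving_rotateSphere (R : SO3) :
    MeasurePreserving (rotateSphere R) (volume : Measure E3).toSphere
      (volume : Measure E3).toSphere := by
  refine ⟨(continuous_rotateSphere R).measurable, Measure.ext fun s hs => ?_⟩
  have hm := (continuous_rotateSphere R).measurable hs
  rw [Measure.map_apply (continuous_rotateSphere R).measurable hs, Measure.toSphere_apply' _ hs,
    Measure.toSphere_apply' _ hm]
  congr 1
  have hcone : Set.Ioo (0 : ℝ) 1 • ((↑) '' (rotateSphere R ⁻¹' s) : Set E3)
      = (rotateIso R).toMeasurableEquiv ⁻¹' (Set.Ioo (0 : ℝ) 1 • ((↑) '' s : Set E3)) := by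
    ext y
    simp only [Set.mem_smul, Set.mem_image, Set.mem_preimage]
    constructor
    · rintro ⟨r, hr, _, ⟨d, hd, rfl⟩, rfl⟩
      exact ⟨r, hr, _, ⟨_, hd, rfl⟩, (rotate_smul R r d.1).symm⟩
    · rintro ⟨r, hr, _, ⟨d, hd, rfl⟩, h⟩
      refine ⟨r, hr, _, ⟨rotateSphere R⁻¹ d, ?_, rfl⟩, ?_⟩
      · have : rotateSphere R (rotateSphere R⁻¹ d) = d := Subtype.ext (rotate_rotate_inv R d.1)
        simpa [this] using hd
      · have h' : r • d.1 = rotate R y := h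
        change r • rotate R⁻¹ d.1 = y
        rw [← rotate_smul, h', rotate_inv_rotate]
  rw [hcone]
  exact (show MeasurePreserving (rotateIso R).toMeasurableEquiv (volume : Measure E3) volume from
    (rotateIso R).measurePreserving).measure_preimage_equiv _

/-! ### The ray space -/

instance : T2Space Ray := inferInstanceAs (T2Space {_x : E3 × E3 // _})

instance : SecondCountableTopology Ray :=
  inferInstanceAs (SecondCountableTopology {_x : E3 × E3 // _})

theorem isClosed_range_ray : IsClosed {x : E3 × E3 | ‖x.1‖ = 1 ∧ inner ℝ x.1 x.2 = 0} :=
  (isClosed_eq (by fun_prop) (by fun_prop)).inter (isClosed_eq (by fun_prop) (by fun_prop))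

theorem isClosedEmbedding_ray_val : Topology.IsClosedEmbedding (Subtype.val : Ray → E3 × E3) :=
  isClosed_range_ray.isClosedEmbedding_subtypeVal

instance : LocallyCompactSpace Ray := isClosedEmbedding_ray_val.locallyCompactSpace

@[fun_prop] theorem continuous_dir : Continuous Ray.dir :=
  continuous_fst.comp continuous_subtype_val

@[fun_prop] theorem continuous_moment : Continuous Ray.moment :=
  continuous_snd.comp continuous_subtype_val

theorem Ray.ext {x y : Ray} (h1 : x.dir = y.dir) (h2 : x.moment = y.moment) : x = y :=
  Subtype.ext (Prod.ext h1 h2)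

theorem moment_smul (g : SE3) (x : Ray) :
    (g • x).moment = rotate g.rot x.moment + cross g.trans (rotate g.rot x.dir) := rfl

@[simp] theorem moment_ofRot_smul (R : SO3) (x : Ray) :
    (ofRot R • x).moment = rotate R x.moment := by
  rw [moment_smul]
  change rotate R x.moment + cross 0 _ = _
  rw [cross_zero_left, add_zero]

instance : ContinuousConstSMul SE3 Ray where
  continuous_const_smul g := by
    refine Continuous.subtype_mk ?_ _
    fun_prop

theorem smul_rayThrough (g : SE3) (p : E3) (d : Metric.sphere (0 : E3) 1) :
    g • rayThrough p d = rayThrough (g • p) (rotateSphere g.rot d) := by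
  refine Ray.ext rfl ?_
  change rotate g.rot (cross p d.1) + cross g.trans (rotate g.rot d.1)
    = cross (rotate g.rot p + g.trans) (rotate g.rot d.1)
  rw [rotate_cross, cross_add_left]

theorem continuous_rayThrough :
    Continuous fun q : Metric.sphere (0 : E3) 1 × E3 => rayThrough q.2 q.1 :=
  Continuous.subtype_mk (by fun_prop) _

theorem continuous_rayThrough_right (p : E3) : Continuous (rayThrough p) :=
  continuous_rayThrough.comp (by fun_prop : Continuous fun d => (d, p))

theorem continuous_rayThrough_left (d : Metric.sphere (0 : E3) 1) :
    Continuous fun p => rayThrough p d :=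
  continuous_rayThrough.comp (by fun_prop : Continuous fun p => (d, p))

theorem cross_smul_self (a : ℝ) (d : E3) : cross (a • d) d = 0 := by
  simp [cross]

theorem rayThrough_add_smul (p : E3) (d : Metric.sphere (0 : E3) 1) (a : ℝ) :
    rayThrough (a • d.1 + p) d = rayThrough p d := by
  refine Ray.ext rfl ?_
  change cross (a • d.1 + p) d.1 = cross p d.1
  rw [cross_add_left, cross_smul_self, zero_add]

/-! ### Invariance of the measures -/

theorem map_smul_pencilMeasure (g : SE3) (x : E3) :
    (pencilMeasure x).map (g • ·) = pencilMeasure (g • x) := by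
  have h1 : Measurable (rayThrough x) := (continuous_rayThrough_right x).measurable
  have h2 : Measurable (rayThrough (g • x)) := (continuous_rayThrough_right _).measurable
  have h3 : (g • · : Ray → Ray) ∘ rayThrough x = rayThrough (g • x) ∘ rotateSphere g.rot :=
    funext fun d => smul_rayThrough g x d
  rw [pencilMeasure, pencilMeasure, Measure.map_map (continuous_const_smul g).measurable h1, h3,
    ← Measure.map_map h2 (continuous_rotateSphere _).measurable,
    (measurePreserving_rotateSphere g.rot).map_eq]

/-- The pairs `(d, p)` used in `rayMeasure`. -/
def slab : Set (Metric.sphere (0 : E3) 1 × E3) := {q | inner ℝ q.2 q.1.1 ∈ Set.Icc (0 : ℝ) 1}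

theorem isClosed_slab : IsClosed slab :=
  isClosed_Icc.preimage (by fun_prop)

theorem rayMeasure_eq : rayMeasure =
    Measure.map (fun q : Metric.sphere (0 : E3) 1 × E3 => rayThrough q.2 q.1)
      (((volume : Measure E3).toSphere.prod volume).restrict slab) := rfl

theorem map_ofRot_rayMeasure (R : SO3) : rayMeasure.map (ofRot R • ·) = rayMeasure := by
  set T : Metric.sphere (0 : E3) 1 × E3 → Metric.sphere (0 : E3) 1 × E3 :=
    Prod.map (rotateSphere R) (rotate R) with hT
  have hTm : MeasurePreserving T ((volume : Measure E3).toSphere.prod volume)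
      ((volume : Measure E3).toSphere.prod volume) :=
    (measurePreserving_rotateSphere R).prod (measurePreserving_rotate R)
  have hS : T ⁻¹' slab = slab := by
    ext q
    change inner ℝ (rotate R q.2) (rotate R q.1.1) ∈ Set.Icc (0 : ℝ) 1 ↔ _
    rw [inner_rotate]
    rfl
  have hr := hTm.restrict_preimage isClosed_slab.measurableSet
  rw [hS] at hr
  have h3 : (ofRot R • · : Ray → Ray) ∘ (fun q : Metric.sphere (0 : E3) 1 × E3 =>
      rayThrough q.2 q.1) = (fun q => rayThrough q.2 q.1) ∘ T := by
    funext q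
    have : ofRot R • q.2 = rotate R q.2 := add_zero _
    change ofRot R • rayThrough q.2 q.1 = rayThrough (rotate R q.2) (rotateSphere R q.1)
    rw [smul_rayThrough, this]
    rfl
  rw [rayMeasure_eq, Measure.map_map (continuous_const_smul _).measurable
    continuous_rayThrough.measurable, h3, ← Measure.map_map continuous_rayThrough.measurable
    hTm.measurable, hr.map_eq]

/-- Adding the unit vector `d` to a point raises its inner product with `d` by one, so each orbit of
ℤd meets a half-open slab of width one exactly once. -/
theorem isAddFundamentalDomain_slab (d : Metric.sphere (0 : E3) 1) (a : ℝ) :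
    IsAddFundamentalDomain (AddSubgroup.zmultiples d.1)
      {p : E3 | inner ℝ p d.1 ∈ Set.Ico a (a + 1)} volume := by
  have hd : inner ℝ d.1 d.1 = (1 : ℝ) := by
    rw [real_inner_self_eq_norm_sq, mem_sphere_zero_iff_norm.1 d.2]; norm_num
  refine IsAddFundamentalDomain.mk' ?_ fun p => ?_
  · exact (measurableSet_Ico.preimage (by fun_prop : Continuous fun p : E3 =>
      inner ℝ p d.1).measurable).nullMeasurableSet
  · obtain ⟨n, hn, huniq⟩ := existsUnique_add_zsmul_mem_Ico (one_pos (α := ℝ)) (inner ℝ p d.1) a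
    have key : ∀ m : ℤ, inner ℝ (m • d.1 + p) d.1 = inner ℝ p d.1 + m • (1 : ℝ) := by
      intro m
      rw [inner_add_left, ← Int.cast_smul_eq_zsmul ℝ m d.1, real_inner_smul_left, hd, add_comm]
      simp
    refine ⟨⟨n • d.1, n, rfl⟩, ?_, ?_⟩
    · change inner ℝ (n • d.1 + p) d.1 ∈ Set.Ico a (a + 1)
      rw [key]; exact hn
    · rintro ⟨_, m, rfl⟩ hm
      have hm' : inner ℝ (m • d.1 + p) d.1 ∈ Set.Ico a (a + 1) := hm
      rw [key] at hm'
      exact Subtype.ext (by simp [huniq m hm'])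

theorem volume_inner_eq (d : Metric.sphere (0 : E3) 1) (c : ℝ) :
    volume {p : E3 | inner ℝ p d.1 = c} = 0 := by
  have hd : inner ℝ d.1 d.1 = (1 : ℝ) := by
    rw [real_inner_self_eq_norm_sq, mem_sphere_zero_iff_norm.1 d.2]; norm_num
  have h : {p : E3 | inner ℝ p d.1 = c} =
      (fun p => (-c) • d.1 + p) ⁻¹' ((ℝ ∙ d.1)ᗮ : Submodule ℝ E3) := by
    ext p
    simp only [Set.mem_ofPred_eq, Set.mem_preimage, SetLike.mem_coe,
      Submodule.mem_orthogonal_singleton_iff_inner_left, inner_add_left, real_inner_smul_left, hd]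
    constructor <;> intro h <;> linarith
  rw [h, measure_preimage_add]
  refine Measure.addHaar_submodule _ _ fun htop => ?_
  have : d.1 ∈ (ℝ ∙ d.1)ᗮ := by rw [htop]; trivial
  rw [Submodule.mem_orthogonal_singleton_iff_inner_left, hd] at this
  exact one_ne_zero this

/-- Translation by `t` shifts the slab by ⟪t, d⟫. The set of points whose ray lies in `A` is
invariant along `d`, and all fundamental domains of ℤd cut out the same volume of such a set. -/
theorem volume_slab_translate (d : Metric.sphere (0 : E3) 1) {A : Set Ray} (hA : MeasurableSet A)
    (t : E3) :
    volume {p : E3 | inner ℝ p d.1 ∈ Set.Icc (0 : ℝ) 1 ∧ rayThrough (t + p) d ∈ A}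
      = volume {p : E3 | inner ℝ p d.1 ∈ Set.Icc (0 : ℝ) 1 ∧ rayThrough p d ∈ A} := by
  -- The closed slab exceeds the fundamental domain only by a hyperplane, which is null.
  have hIcc : ∀ a : ℝ, volume {p : E3 | inner ℝ p d.1 ∈ Set.Icc a (a + 1) ∧ rayThrough p d ∈ A}
      = volume ({p : E3 | rayThrough p d ∈ A} ∩ {p | inner ℝ p d.1 ∈ Set.Ico a (a + 1)}) := by
    intro a
    refine measure_congr ?_
    have h0 := measure_eq_zero_iff_ae_notMem.1 (volume_inner_eq d (a + 1))
    filter_upwards [h0] with p hp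
    have hp' : inner ℝ p d.1 ≠ a + 1 := hp
    refine propext ?_
    change (_ ∈ Set.Icc a (a + 1) ∧ _) ↔ (_ ∧ _ ∈ Set.Ico a (a + 1))
    simp only [Set.mem_Icc, Set.mem_Ico, lt_iff_le_and_ne]
    tauto
  have hdom : ∀ a b : ℝ,
      volume {p : E3 | inner ℝ p d.1 ∈ Set.Icc a (a + 1) ∧ rayThrough p d ∈ A}
      = volume {p : E3 | inner ℝ p d.1 ∈ Set.Icc b (b + 1) ∧ rayThrough p d ∈ A} := by
    intro a b
    rw [hIcc, hIcc]
    refine (isAddFundamentalDomain_slab d a).measure_set_eq (isAddFundamentalDomain_slab d b)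
      (hA.preimage (continuous_rayThrough_left d).measurable) ?_
    rintro ⟨_, m, rfl⟩
    ext p
    change rayThrough (m • d.1 + p) d ∈ A ↔ rayThrough p d ∈ A
    rw [← Int.cast_smul_eq_zsmul ℝ m d.1, rayThrough_add_smul]
  have hshift : {p : E3 | inner ℝ p d.1 ∈ Set.Icc (0 : ℝ) 1 ∧ rayThrough (t + p) d ∈ A}
      = (fun p => t + p) ⁻¹' {p : E3 | inner ℝ p d.1 ∈
        Set.Icc (inner ℝ t d.1) (inner ℝ t d.1 + 1) ∧ rayThrough p d ∈ A} := by
    ext p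
    simp only [Set.mem_ofPred_eq, Set.mem_preimage, inner_add_left, Set.mem_Icc,
      le_add_iff_nonneg_right, add_le_add_iff_left]
  rw [hshift, measure_preimage_add, hdom _ 0, zero_add]

theorem rayMeasure_apply {A : Set Ray} (hA : MeasurableSet A) :
    rayMeasure A = ∫⁻ d, volume {p : E3 | inner ℝ p d.1 ∈ Set.Icc (0 : ℝ) 1 ∧
      rayThrough p d ∈ A} ∂(volume : Measure E3).toSphere := by
  have hpre := hA.preimage continuous_rayThrough.measurable
  rw [rayMeasure_eq, Measure.map_apply continuous_rayThrough.measurable hA,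
    Measure.restrict_apply hpre, Measure.prod_apply (hpre.inter isClosed_slab.measurableSet)]
  refine lintegral_congr fun d => congrArg _ ?_
  ext p
  exact and_comm

theorem map_sec_rayMeasure (t : E3) : rayMeasure.map (sec t • ·) = rayMeasure := by
  refine Measure.ext fun A hA => ?_
  have hm : Measurable (sec t • · : Ray → Ray) := (continuous_const_smul _).measurable
  rw [Measure.map_apply hm hA, rayMeasure_apply (hA.preimage hm), rayMeasure_apply hA]
  refine lintegral_congr fun d => ?_
  rw [← volume_slab_translate d hA t]
  have : ∀ p, sec t • rayThrough p d = rayThrough (t + p) d := by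
    intro p
    have h1 : sec t • p = t + p := by
      change rotate 1 p + t = _
      rw [rotate_one, add_comm]
    have h2 : rotateSphere (sec t).rot d = d := Subtype.ext (rotate_one _)
    rw [smul_rayThrough, h1, h2]
  simp [Set.mem_preimage, this]

theorem map_smul_rayMeasure (g : SE3) : rayMeasure.map (g • ·) = rayMeasure := by
  have hg : (g • · : Ray → Ray) = (sec g.trans • ·) ∘ (ofRot g.rot • ·) := by
    funext x
    have : g = sec g.trans * ofRot g.rot := by
      ext1 <;> simp [sec, ofRot, rotate_zero]
    simp only [Function.comp_apply, ← mul_smul, ← this]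
  rw [hg, ← Measure.map_map (continuous_const_smul _).measurable
    (continuous_const_smul _).measurable, map_ofRot_rayMeasure, map_sec_rayMeasure]

/-! ### Local finiteness of the ray measure and its positivity on open sets -/

theorem norm_cross_sq (p d : E3) :
    ‖cross p d‖ ^ 2 = ‖p‖ ^ 2 * ‖d‖ ^ 2 - inner ℝ p d ^ 2 := by
  simp only [← real_inner_self_eq_norm_sq, inner_eq]
  simp [cross, cross_apply]
  ring

instance : IsLocallyFiniteMeasure rayMeasure := by
  refine ⟨fun x => ⟨{y | ‖y.moment‖ < ‖x.moment‖ + 1}, ?_, ?_⟩⟩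
  · exact (isOpen_lt (by fun_prop) (by fun_prop)).mem_nhds (by simp)
  · set M := ‖x.moment‖ + 1
    have hM : 0 ≤ M := by positivity
    rw [rayMeasure_apply (isOpen_lt (by fun_prop) (by fun_prop)).measurableSet]
    calc _ ≤ ∫⁻ _, volume (Metric.closedBall (0 : E3) (M + 1)) ∂(volume : Measure E3).toSphere := by
          refine lintegral_mono fun d => measure_mono fun p hp => ?_
          obtain ⟨⟨h0, h1⟩, h2⟩ := hp
          have h2' : ‖cross p d.1‖ < M := h2
          -- Pythagoras: ‖p‖² = ‖p × d‖² + ⟪p, d⟫² ≤ M² + 1 ≤ (M + 1)².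
          have h3 := norm_cross_sq p d.1
          rw [mem_sphere_zero_iff_norm.1 d.2] at h3
          rw [mem_closedBall_zero_iff]
          refine abs_le_of_sq_le_sq' ?_ (by positivity) |>.2
          nlinarith [norm_nonneg (cross p d.1)]
      _ < ⊤ := by
          rw [lintegral_const]
          exact ENNReal.mul_lt_top measure_closedBall_lt_top (measure_lt_top _ _)

/-- (d × m) × d = m for `d` a unit vector orthogonal to `m`: the point d × m is the foot of the
perpendicular from the origin. -/
theorem rayThrough_cross (x : Ray) (a : ℝ) :
    rayThrough (a • x.dir + cross x.dir x.moment) ⟨x.dir, by simp [x.norm_dir]⟩ = x := by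
  refine Ray.ext rfl ?_
  change cross (a • x.dir + cross x.dir x.moment) x.dir = x.moment
  rw [cross_add_left, cross_smul_self, zero_add]
  have h1 := (norm_eq_one_iff _).1 x.norm_dir
  have h2 := x.inner_dir_moment
  rw [inner_eq] at h2
  ext i
  fin_cases i <;> simp [cross, cross_apply]
  · linear_combination x.moment 0 * h1 - x.dir 0 * h2
  · linear_combination x.moment 1 * h1 - x.dir 1 * h2
  · linear_combination x.moment 2 * h1 - x.dir 2 * h2

instance : rayMeasure.IsOpenPosMeasure := by
  refine ⟨fun U hU hne => ?_⟩
  obtain ⟨x, hx⟩ := hne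
  rw [rayMeasure_eq, Measure.map_apply continuous_rayThrough.measurable hU.measurableSet,
    Measure.restrict_apply (hU.measurableSet.preimage continuous_rayThrough.measurable)]
  have hV : IsOpen ((fun q : Metric.sphere (0 : E3) 1 × E3 => rayThrough q.2 q.1) ⁻¹' U ∩
      {q | inner ℝ q.2 q.1.1 ∈ Set.Ioo (0 : ℝ) 1}) :=
    (hU.preimage continuous_rayThrough).inter (isOpen_Ioo.preimage (by fun_prop))
  have hVne : ((fun q : Metric.sphere (0 : E3) 1 × E3 => rayThrough q.2 q.1) ⁻¹' U ∩
      {q | inner ℝ q.2 q.1.1 ∈ Set.Ioo (0 : ℝ) 1}).Nonempty := by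
    -- The coefficient 1/2 places the point on the middle plane of the slab, hence in its interior.
    refine ⟨(⟨x.dir, by simp [x.norm_dir]⟩, (2⁻¹ : ℝ) • x.dir + cross x.dir x.moment), ?_, ?_⟩
    · simpa [rayThrough_cross] using hx
    · change inner ℝ ((2⁻¹ : ℝ) • x.dir + cross x.dir x.moment) x.dir ∈ Set.Ioo (0 : ℝ) 1
      rw [inner_add_left, real_inner_smul_left, real_inner_self_eq_norm_sq, x.norm_dir,
        real_inner_comm, inner_self_cross]
      norm_num
  refine ne_of_gt (lt_of_lt_of_le (hV.measure_pos _ hVne) (measure_mono ?_))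
  exact Set.inter_subset_inter_right _ fun q hq => Set.Ioo_subset_Icc_self hq

/-! ### Equivariance of the convolution and the kernel constraint -/

theorem inv_sec_mul (g : SE3) (x : E3) :
    (sec x)⁻¹ * g = ofRot g.rot * (sec (g⁻¹ • x))⁻¹ := by
  have h : (g⁻¹ • x : E3) = rotate g.rot⁻¹ x + -rotate g.rot⁻¹ g.trans := rfl
  ext1
  · simp [sec, ofRot]
  · simp only [SE3.mul_trans, SE3.inv_rot, SE3.inv_trans, sec, ofRot, inv_one, rotate_one, h,
      neg_add, neg_neg, rotate_add, rotate_neg, rotate_rotate_inv, add_zero]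
    abel

theorem twist_inv (g : SE3) (x : E3) : (twist g⁻¹ x)⁻¹ = g.rot := by
  simp [twist, sec]

/-- The hypothesis on `ν` covers both uses: a single invariant measure, and the pencils, which `g`
permutes. -/
theorem convEquivariant_of_ae {n : ℕ} {ρ : Representation ℝ SO3 (Fin n → ℝ)}
    {ν : E3 → Measure Ray} (hν : ∀ (g : SE3) (x : E3), (ν x).map (g • ·) = ν (g • x))
    {κ : Ray → Fin n → ℝ}
    (h : ∀ (R : SO3) (x : E3), ∀ᵐ y ∂ν x,
      κ (ofRot R • (sec x)⁻¹ • y) = ρ R (κ ((sec x)⁻¹ • y))) :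
    ConvEquivariant ρ ν κ := by
  intro f hf g
  have hemb : MeasurableEmbedding (g • · : Ray → Ray) := (Homeomorph.smul g).measurableEmbedding
  set T : (Fin n → ℝ) →L[ℝ] (Fin n → ℝ) := LinearMap.toContinuousLinearMap (ρ g.rot) with hT
  have hνx : ∀ x, ν x = (ν (g⁻¹ • x)).map (g • ·) := fun x => by rw [hν, smul_inv_smul]
  have hae : ∀ x, (fun z => actIn g f (g • z) • κ ((sec x)⁻¹ • g • z))
      =ᵐ[ν (g⁻¹ • x)] fun z => T (f z • κ ((sec (g⁻¹ • x))⁻¹ • z)) := by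
    intro x
    filter_upwards [h g.rot (g⁻¹ • x)] with z hz
    have h1 : (sec x)⁻¹ • g • z = ofRot g.rot • (sec (g⁻¹ • x))⁻¹ • z := by
      rw [← mul_smul, ← mul_smul, inv_sec_mul]
    rw [h1, hz, map_smul, actIn, inv_smul_smul]
    rfl
  refine ⟨fun x => ?_, funext fun x => ?_⟩
  · rw [hνx x, hemb.integrable_map_iff]
    exact (T.integrable_comp (hf (g⁻¹ • x))).congr (hae x).symm
  · rw [conv, hνx x, hemb.integral_map, integral_congr_ae (hae x),
      T.integral_comp_comm (hf (g⁻¹ • x)), actOut, twist_inv]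
    rfl

theorem measurePreserving_smul_ray (g : SE3) :
    MeasurePreserving (g • · : Ray → Ray) rayMeasure rayMeasure :=
  ⟨(continuous_const_smul g).measurable, map_smul_rayMeasure g⟩

theorem locallyIntegrable_comp_smul {n : ℕ} {κ : Ray → Fin n → ℝ}
    (hκ : LocallyIntegrable κ rayMeasure) (g : SE3) :
    LocallyIntegrable (fun y => κ (g • y)) rayMeasure := by
  have := (locallyIntegrable_map_homeomorph (Homeomorph.smul g) (f := κ) (μ := rayMeasure)).1
  refine this ?_
  change LocallyIntegrable κ (rayMeasure.map (g • ·))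
  rwa [map_smul_rayMeasure]

theorem convEquivariant_rayMeasure_iff {n : ℕ} (ρ : Representation ℝ SO3 (Fin n → ℝ))
    {κ : Ray → Fin n → ℝ} (hκ : LocallyIntegrable κ rayMeasure) :
    ConvEquivariant ρ (fun _ => rayMeasure) κ ↔
      ∀ R : SO3, ∀ᵐ x ∂rayMeasure, κ (ofRot R • x) = ρ R (κ x) := by
  constructor
  · intro h R
    set T : (Fin n → ℝ) →L[ℝ] (Fin n → ℝ) := LinearMap.toContinuousLinearMap (ρ R) with hT
    have hTκ : LocallyIntegrable (fun x => T (κ x)) rayMeasure := by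
      intro x
      obtain ⟨U, hU, hi⟩ := hκ x
      exact ⟨U, hU, T.integrable_comp hi⟩
    have hκR := locallyIntegrable_comp_smul hκ (ofRot R)
    have key : (fun x => κ (ofRot R • x) - T (κ x)) =ᵐ[rayMeasure] 0 := by
      refine ae_eq_zero_of_forall_setIntegral_isCompact_eq_zero' (hκR.sub hTκ) fun K hK => ?_
      have hind : ∀ (s : Ray → Fin n → ℝ), (fun y => K.indicator (fun _ => (1 : ℝ)) y • s y)
          = K.indicator s := by
        intro s; funext y
        by_cases hy : y ∈ K <;> simp [hy]
      -- Equivariance speaks only of fields with convergent convolution; local integrability of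
      -- every translate of `κ` admits indicators of compact sets.
      have hdef : ConvDefined (fun _ => rayMeasure) κ (K.indicator fun _ => 1) := by
        intro x
        simp only [hind]
        exact ((locallyIntegrable_comp_smul hκ (sec x)⁻¹).integrableOn_isCompact hK).integrable_indicator
          hK.measurableSet
      -- The origin is fixed by `R` and has trivial section, so there the equivariance says ∫_K κ(R
      -- y) dy = ρ(R) ∫_K κ(y) dy after a rotation of the variable.
      have heq := congrFun (h _ hdef (ofRot R)).2 0
      have hsec : (sec 0)⁻¹ = 1 := by
        ext1 <;> simp [sec, rotate_zero]
      have hzero : ((ofRot R)⁻¹ • (0 : E3)) = 0 := by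
        change rotate R⁻¹ 0 + -rotate R⁻¹ 0 = 0
        simp [rotate_zero]
      rw [actOut, twist_inv, hzero] at heq
      simp only [conv, hsec, one_smul, hind] at heq
      rw [integral_indicator hK.measurableSet] at heq
      have hleft : ∫ y, actIn (ofRot R) (K.indicator fun _ => (1 : ℝ)) y • κ y ∂rayMeasure
          = ∫ x in K, κ (ofRot R • x) ∂rayMeasure := by
        have hemb : MeasurableEmbedding (ofRot R • · : Ray → Ray) :=
          (Homeomorph.smul (ofRot R)).measurableEmbedding
        rw [← (measurePreserving_smul_ray (ofRot R)).integral_comp hemb,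
          ← integral_indicator hK.measurableSet, ← hind]
        simp [actIn]
      rw [hleft] at heq
      rw [integral_sub (hκR.integrableOn_isCompact hK) (hTκ.integrableOn_isCompact hK), heq,
        T.integral_comp_comm (hκ.integrableOn_isCompact hK), sub_eq_zero]
      rfl
    filter_upwards [key] with x hx
    exact sub_eq_zero.1 hx
  · intro h
    refine convEquivariant_of_ae (fun g _ => map_smul_rayMeasure g) fun R x => ?_
    exact (measurePreserving_smul_ray (sec x)⁻¹).quasiMeasurePreserving.ae (h R)

theorem convEquivariant_rayMeasure_iff_of_continuous {n : ℕ}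
    (ρ : Representation ℝ SO3 (Fin n → ℝ)) {κ : Ray → Fin n → ℝ} (hκ : Continuous κ) :
    ConvEquivariant ρ (fun _ => rayMeasure) κ ↔ KernelConstraint ρ κ := by
  rw [convEquivariant_rayMeasure_iff ρ hκ.locallyIntegrable]
  refine forall_congr' fun R => ⟨fun h => ?_, fun h => Filter.Eventually.of_forall h⟩
  have h1 : Continuous fun x => κ (ofRot R • x) := hκ.comp (continuous_const_smul _)
  have h2 : Continuous fun x => ρ R (κ x) := (ρ R).continuous_of_finiteDimensional.comp hκ
  exact congrFun (Continuous.ae_eq_iff_eq rayMeasure h1 h2 |>.1 h)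

/-! ### Truncated kernels and rays through a point -/

theorem KernelConstraint.truncate {n : ℕ} {ρ : Representation ℝ SO3 (Fin n → ℝ)}
    {κ : Ray → Fin n → ℝ} (hκ : KernelConstraint ρ κ) (d₀ : ℝ) :
    KernelConstraint ρ (truncate d₀ κ) := by
  intro R x
  simp only [RayConv.truncate, moment_ofRot_smul, norm_rotate, hκ R x]
  split_ifs <;> simp

theorem moment_inv_sec_smul_rayThrough (x : E3) (d : Metric.sphere (0 : E3) 1) :
    ((sec x)⁻¹ • rayThrough x d).moment = 0 := by
  have h : ((sec x)⁻¹ • x : E3) = 0 := by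
    change rotate 1⁻¹ x + -rotate 1⁻¹ x = 0
    simp
  rw [smul_rayThrough, h]
  exact cross_zero_left _

/-- A ray through `x` is determined by its direction, so `rayThrough x` is a measurable embedding
and `P` need not be measurable. -/
theorem ae_pencilMeasure {x : E3} {P : Ray → Prop} (h : ∀ d, P (rayThrough x d)) :
    ∀ᵐ y ∂pencilMeasure x, P y := by
  have hemb : MeasurableEmbedding (rayThrough x) := by
    refine (continuous_rayThrough_right x).measurableEmbedding fun d e hde => ?_
    exact Subtype.ext (congrArg Ray.dir hde)
  exact hemb.ae_map_iff.2 (Filter.Eventually.of_forall h)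

theorem conv_truncate_zero {n : ℕ} {κ : Ray → Fin n → ℝ} {c : ℝ} {Y : E3 → Fin n → ℝ}
    (hκ : ∀ x : Ray, x.moment = 0 → κ x = c • Y x.dir) (f : Ray → ℝ) (x : E3) :
    conv pencilMeasure (truncate 0 κ) f x = c • conv pencilMeasure (fun y => Y y.dir) f x := by
  rw [conv, conv, ← integral_smul]
  refine integral_congr_ae (ae_pencilMeasure fun d => ?_)
  have hm := moment_inv_sec_smul_rayThrough x d
  have htr : truncate 0 κ ((sec x)⁻¹ • rayThrough x d) = κ ((sec x)⁻¹ • rayThrough x d) := by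
    simp [truncate, hm]
  simp only [htr, hκ _ hm, smul_comm c]

/-! ### Coefficients of harmonic polynomials -/

open MvPolynomial in
theorem coeff_laplacian (p : MvPolynomial (Fin 3) ℝ) (s : Fin 3 →₀ ℕ) :
    coeff s (laplacian p) = ∑ i, coeff (s + Finsupp.single i 2) p * ((s i + 2) * (s i + 1)) := by
  simp only [laplacian, LinearMap.sum_apply, coeff_sum]
  refine Finset.sum_congr rfl fun i _ => ?_
  change coeff s (pderiv i (pderiv i p)) = _
  rw [coeff_pderiv, coeff_pderiv, add_assoc, ← Finsupp.single_add]
  simp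
  ring

theorem degree_fin_three (s : Fin 3 →₀ ℕ) : s.degree = s 0 + s 1 + s 2 := by
  rw [Finsupp.degree_eq_sum, Fin.sum_univ_three]

theorem Harmonics.coeff_eq_zero {l : ℕ} {p : MvPolynomial (Fin 3) ℝ} (hp : p ∈ Harmonics l)
    {s : Fin 3 →₀ ℕ} (hs : s 0 + s 1 + s 2 ≠ l) : p.coeff s = 0 :=
  MvPolynomial.IsHomogeneous.coeff_eq_zero hp.1 (by rwa [degree_fin_three])

theorem Harmonics.sum_coeff {l : ℕ} {p : MvPolynomial (Fin 3) ℝ} (hp : p ∈ Harmonics l)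
    (s : Fin 3 →₀ ℕ) :
    ∑ i, p.coeff (s + Finsupp.single i 2) * ((s i + 2) * (s i + 1)) = (0 : ℝ) := by
  rw [← coeff_laplacian, show laplacian p = 0 from hp.2, MvPolynomial.coeff_zero]

/-- The exponent `(a, b, c)`. -/
def expo (a b c : ℕ) : Fin 3 →₀ ℕ := Finsupp.equivFunOnFinite.symm ![a, b, c]

@[simp] theorem expo_zero (a b c : ℕ) : expo a b c 0 = a := rfl
@[simp] theorem expo_one (a b c : ℕ) : expo a b c 1 = b := rfl
@[simp] theorem expo_two (a b c : ℕ) : expo a b c 2 = c := rfl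

theorem expo_ext {s t : Fin 3 →₀ ℕ} (h0 : s 0 = t 0) (h1 : s 1 = t 1) (h2 : s 2 = t 2) :
    s = t := by
  ext i; fin_cases i <;> assumption

/-- A harmonic polynomial is determined by its coefficients of degree at most one in the last
variable. -/
theorem Harmonics.eq_zero_of_coeff {l : ℕ} {p : MvPolynomial (Fin 3) ℝ} (hp : p ∈ Harmonics l)
    (h : ∀ s : Fin 3 →₀ ℕ, s 2 ≤ 1 → p.coeff s = 0) : p = 0 := by
  have key : ∀ n : ℕ, ∀ s : Fin 3 →₀ ℕ, s 2 = n → p.coeff s = 0 := by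
    intro n
    induction n using Nat.strong_induction_on with
    | _ n ih =>
      intro s hs
      by_cases hn : s 2 ≤ 1
      · exact h s hn
      -- The Laplace equation at this exponent expresses the coefficient at `s` through two others
      -- whose last exponent is `s 2 - 2`.
      · have h1 := Harmonics.sum_coeff hp (expo (s 0) (s 1) (s 2 - 2))
        have h2 : expo (s 0) (s 1) (s 2 - 2) + Finsupp.single 2 2 = s :=
          expo_ext (by simp) (by simp) (by simp; omega)
        rw [Fin.sum_univ_three, h2, ih (s 2 - 2) (by omega) _ (by simp),
          ih (s 2 - 2) (by omega) _ (by simp), zero_mul, zero_mul, zero_add, zero_add] at h1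
        exact (mul_eq_zero.1 h1).resolve_right (by positivity)
  exact MvPolynomial.ext _ _ fun s => by simpa using key _ s rfl

/-- The coefficients of the harmonic polynomial with given coefficients of degree at most one in
the last variable. -/
def harmonicCoeff (u : ℕ → ℕ → ℕ → ℝ) : ℕ → ℕ → ℕ → ℝ
  | 0, a, b => u 0 a b
  | 1, a, b => u 1 a b
  | c + 2, a, b => -(harmonicCoeff u c (a + 2) b * ((a + 2) * (a + 1))
      + harmonicCoeff u c a (b + 2) * ((b + 2) * (b + 1))) / ((c + 2) * (c + 1))

theorem harmonicCoeff_rec (u : ℕ → ℕ → ℕ → ℝ) (a b c : ℕ) :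
    harmonicCoeff u c (a + 2) b * ((a + 2) * (a + 1))
      + harmonicCoeff u c a (b + 2) * ((b + 2) * (b + 1))
      + harmonicCoeff u (c + 2) a b * ((c + 2) * (c + 1)) = 0 := by
  have : ((c : ℝ) + 2) * (c + 1) ≠ 0 := by positivity
  rw [harmonicCoeff, div_mul_cancel₀ _ this]
  ring

/-- The harmonic polynomial with given coefficients of degree at most one in the last variable. -/
def harmonicExtension (l : ℕ) (u : ℕ → ℕ → ℕ → ℝ) : MvPolynomial (Fin 3) ℝ :=
  ∑ s ∈ Finset.finsuppAntidiag Finset.univ l,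
    MvPolynomial.monomial s (harmonicCoeff u (s 2) (s 0) (s 1))

theorem coeff_harmonicExtension (l : ℕ) (u : ℕ → ℕ → ℕ → ℝ) (s : Fin 3 →₀ ℕ) :
    (harmonicExtension l u).coeff s =
      if s 0 + s 1 + s 2 = l then harmonicCoeff u (s 2) (s 0) (s 1) else 0 := by
  simp [harmonicExtension, MvPolynomial.coeff_sum, MvPolynomial.coeff_monomial,
    Finset.mem_finsuppAntidiag, Fin.sum_univ_three]

/-- The recursion is the Laplace equation coefficientwise. Its three terms have equal degree, so
restricting to degree `l` keeps all of them or none. -/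
theorem harmonicExtension_mem (l : ℕ) (u : ℕ → ℕ → ℕ → ℝ) :
    harmonicExtension l u ∈ Harmonics l := by
  refine ⟨fun s hs => ?_, ?_⟩
  · rw [coeff_harmonicExtension] at hs
    have : s 0 + s 1 + s 2 = l := by
      by_contra h
      exact hs (if_neg h)
    rw [← this, ← degree_fin_three, Finsupp.degree_eq_weight_one]
    rfl
  · change laplacian _ = 0
    ext s
    rw [coeff_laplacian, Fin.sum_univ_three]
    simp only [coeff_harmonicExtension, MvPolynomial.coeff_zero]
    have h0 : s 0 + 2 + s 1 + s 2 = s 0 + s 1 + s 2 + 2 := by ring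
    have h1 : s 0 + (s 1 + 2) + s 2 = s 0 + s 1 + s 2 + 2 := by ring
    have h2 : s 0 + s 1 + (s 2 + 2) = s 0 + s 1 + s 2 + 2 := by ring
    by_cases h : s 0 + s 1 + s 2 + 2 = l
    · simpa [h0, h1, h2, h] using harmonicCoeff_rec u (s 0) (s 1) (s 2)
    · simp [h0, h1, h2, h]

/-- The coefficients of degree at most one in the last variable. -/
def initialCoeffs (l : ℕ) : Harmonics l →ₗ[ℝ] (Fin (l + 1) ⊕ Fin l → ℝ) where
  toFun p := Sum.elim (fun i => p.1.coeff (expo i (l - i) 0))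
    (fun j => p.1.coeff (expo j (l - 1 - j) 1))
  map_add' p q := by
    funext i; rcases i with i | i <;> simp
  map_smul' a p := by
    funext i; rcases i with i | i <;> simp

/-- The Laplace equation is a two-step recursion in the last exponent, so the coefficients with last
exponent 0 or 1 are free Cauchy data. For `l = 0` the second family is empty, and the truncated `l -
1` is harmless. -/
theorem initialCoeffs_bijective (l : ℕ) : Function.Bijective (initialCoeffs l) := by
  constructor
  · refine (injective_iff_map_eq_zero _).2 fun p hp => Subtype.ext ?_
    refine Harmonics.eq_zero_of_coeff p.2 fun s hs => ?_
    by_cases hl : s 0 + s 1 + s 2 = l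
    swap
    · exact Harmonics.coeff_eq_zero p.2 hl
    rcases Nat.le_one_iff_eq_zero_or_eq_one.1 hs with h | h
    · have := congrFun hp (Sum.inl ⟨s 0, by omega⟩)
      have hs' : expo (s 0) (l - s 0) 0 = s :=
        expo_ext (by simp) (by simp; omega) (by simp [h])
      simpa [initialCoeffs, hs'] using this
    · have := congrFun hp (Sum.inr ⟨s 0, by omega⟩)
      have hs' : expo (s 0) (l - 1 - s 0) 1 = s :=
        expo_ext (by simp) (by simp; omega) (by simp [h])
      simpa [initialCoeffs, hs'] using this
  · intro g
    -- The degree forces the second exponent, so `u` ignores it.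
    let u : ℕ → ℕ → ℕ → ℝ := fun c a _ =>
      if c = 0 then (if h : a < l + 1 then g (Sum.inl ⟨a, h⟩) else 0)
      else (if h : a < l then g (Sum.inr ⟨a, h⟩) else 0)
    refine ⟨⟨harmonicExtension l u, harmonicExtension_mem l u⟩, funext fun i => ?_⟩
    rcases i with i | i
    · have : i.1 + (l - i.1) = l := by omega
      simp [initialCoeffs, coeff_harmonicExtension, this, harmonicCoeff, u]
      exact fun h => absurd i.2 (by omega)
    · have : i.1 + (l - 1 - i.1) + 1 = l := by omega
      simp [initialCoeffs, coeff_harmonicExtension, this, harmonicCoeff, u]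

theorem finrank_harmonics (l : ℕ) : Module.finrank ℝ (Harmonics l) = 2 * l + 1 := by
  rw [(LinearEquiv.ofBijective _ (initialCoeffs_bijective l)).finrank_eq,
    Module.finrank_fintype_fun_eq_card, Fintype.card_sum, Fintype.card_fin, Fintype.card_fin]
  ring

instance (l : ℕ) : FiniteDimensional ℝ (Harmonics l) :=
  Module.finite_of_finrank_pos (by rw [finrank_harmonics]; omega)

/-! ### The infinitesimal rotation about the third axis -/

/-- The infinitesimal rotation `x ∂_y - y ∂_x`. -/
def infRot : MvPolynomial (Fin 3) ℝ →ₗ[ℝ] MvPolynomial (Fin 3) ℝ :=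
  LinearMap.mulLeft ℝ (MvPolynomial.X 0) ∘ₗ (MvPolynomial.pderiv 1).toLinearMap
    - LinearMap.mulLeft ℝ (MvPolynomial.X 1) ∘ₗ (MvPolynomial.pderiv 0).toLinearMap

open MvPolynomial in
theorem infRot_apply (p : MvPolynomial (Fin 3) ℝ) :
    infRot p = X 0 * pderiv 1 p - X 1 * pderiv 0 p := rfl

open MvPolynomial in
theorem laplacian_apply (p : MvPolynomial (Fin 3) ℝ) :
    laplacian p = pderiv 0 (pderiv 0 p) + pderiv 1 (pderiv 1 p) + pderiv 2 (pderiv 2 p) := by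
  simp [laplacian, Fin.sum_univ_three]

open MvPolynomial in
theorem pderiv_comm (i j : Fin 3) (p : MvPolynomial (Fin 3) ℝ) :
    pderiv i (pderiv j p) = pderiv j (pderiv i p) := by
  ext s
  rw [coeff_pderiv, coeff_pderiv, coeff_pderiv, coeff_pderiv, add_right_comm]
  rcases eq_or_ne i j with rfl | h
  · rfl
  · simp [h, h.symm]
    ring

open MvPolynomial in
theorem laplacian_infRot (p : MvPolynomial (Fin 3) ℝ) :
    laplacian (infRot p) = infRot (laplacian p) := by
  have e10 : ∀ q, pderiv 1 (pderiv 0 q) = pderiv 0 (pderiv (R := ℝ) (1 : Fin 3) q) := pderiv_comm 1 0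
  have e20 : ∀ q, pderiv 2 (pderiv 0 q) = pderiv 0 (pderiv (R := ℝ) (2 : Fin 3) q) := pderiv_comm 2 0
  have e21 : ∀ q, pderiv 2 (pderiv 1 q) = pderiv 1 (pderiv (R := ℝ) (2 : Fin 3) q) := pderiv_comm 2 1
  simp only [laplacian_apply, infRot_apply, map_sub, map_add, pderiv_mul, pderiv_X, Pi.single_apply,
    e10, e20, e21]
  simp
  ring

open MvPolynomial in
theorem infRot_mem {l : ℕ} {p : MvPolynomial (Fin 3) ℝ} (hp : p ∈ Harmonics l) :
    infRot p ∈ Harmonics l := by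
  refine ⟨?_, ?_⟩
  · have h : p.IsHomogeneous l := hp.1
    change (infRot p).IsHomogeneous l
    rw [infRot_apply]
    -- A derivative has degree `l - 1`, and a variable restores degree `l` only when `l > 0`;
    -- constants are treated apart.
    rcases Nat.eq_zero_or_pos l with rfl | hl
    · rw [← totalDegree_zero_iff_isHomogeneous] at h
      rw [totalDegree_eq_zero_iff_eq_C.1 h]
      simpa using isHomogeneous_zero (Fin 3) ℝ 0
    · have h1 : ∀ i j : Fin 3, (X i * pderiv j p).IsHomogeneous l := fun i j => by
        have := (isHomogeneous_X ℝ i).mul (h.pderiv (i := j))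
        rwa [Nat.add_sub_cancel' hl] at this
      exact (h1 0 1).sub (h1 1 0)
  · change laplacian _ = 0
    rw [laplacian_infRot, show laplacian p = 0 from hp.2, map_zero]

/-- The infinitesimal rotation on harmonic polynomials. -/
def infRotH (l : ℕ) : Harmonics l →ₗ[ℝ] Harmonics l :=
  infRot.restrict fun _ hp => infRot_mem hp

open MvPolynomial in
theorem coeff_X_mul_pderiv (i : Fin 3) (p : MvPolynomial (Fin 3) ℝ) (s : Fin 3 →₀ ℕ) :
    coeff s (X i * pderiv i p) = s i * coeff s p := by
  rw [coeff_X_mul']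
  split_ifs with h
  · rw [Finsupp.mem_support_iff] at h
    have h1 : s - Finsupp.single i 1 + Finsupp.single i 1 = s :=
      tsub_add_cancel_of_le (Finsupp.single_le_iff.2 (Nat.one_le_iff_ne_zero.2 h))
    rw [coeff_pderiv, h1]
    have : ((s i - 1 : ℕ) : ℝ) + 1 = s i := by
      rw [Nat.cast_sub (Nat.one_le_iff_ne_zero.2 h)]; simp
    simp [this, mul_comm]
  · rw [Finsupp.notMem_support_iff] at h
    simp [h]

open MvPolynomial in
-- In polar coordinates of the first two variables this is (r ∂_r)² + ∂_θ² = r² Δ, with ∂_θ the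
-- infinitesimal rotation.
theorem infRot_casimir (p : MvPolynomial (Fin 3) ℝ) :
    (X 0 * pderiv 0 (X 0 * pderiv 0 p + X 1 * pderiv 1 p)
      + X 1 * pderiv 1 (X 0 * pderiv 0 p + X 1 * pderiv 1 p)) + infRot (infRot p)
      = X 0 * (X 0 * (pderiv 0 (pderiv 0 p) + pderiv 1 (pderiv 1 p)))
        + X 1 * (X 1 * (pderiv 0 (pderiv 0 p) + pderiv 1 (pderiv 1 p))) := by
  simp only [infRot_apply, map_sub, map_add, pderiv_mul, pderiv_X, Pi.single_apply,
    pderiv_comm 1 0]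
  simp
  ring

open MvPolynomial in
/-- A harmonic polynomial that is invariant under rotations about the third axis is determined by
its coefficient at the power of the last variable. -/
theorem eq_zero_of_infRot_eq_zero {l : ℕ} {p : MvPolynomial (Fin 3) ℝ} (hp : p ∈ Harmonics l)
    (hL : infRot p = 0) (h0 : coeff (expo 0 0 l) p = 0) : p = 0 := by
  have hD : pderiv 0 (pderiv 0 p) + pderiv 1 (pderiv 1 p) = -pderiv 2 (pderiv 2 p) := by
    have : laplacian p = 0 := hp.2
    rw [laplacian_apply] at this
    exact eq_neg_of_add_eq_zero_left this
  have hC := infRot_casimir p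
  rw [hL, map_zero, add_zero, hD] at hC
  -- Now (x ∂_x + y ∂_y)² p = -(x² + y²) ∂_z² p. On the left the coefficient at `s` is multiplied by
  -- (s 0 + s 1)²; the right involves only coefficients with last exponent `s 2 + 2`.
  have hc : ∀ s : Fin 3 →₀ ℕ, (∀ t : Fin 3 →₀ ℕ, t 2 = s 2 + 2 → coeff t p = 0) →
      ((s 0 : ℝ) + s 1) ^ 2 * coeff s p = 0 := by
    intro s hs
    have h2 := congrArg (coeff s) hC
    have hv : ∀ i : Fin 3, i ≠ 2 → coeff s (X i * (X i * -pderiv 2 (pderiv 2 p))) = 0 := by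
      intro i hi
      rw [coeff_X_mul']
      split_ifs
      swap
      · rfl
      rw [coeff_X_mul']
      split_ifs
      swap
      · rfl
      rw [coeff_neg, coeff_pderiv, coeff_pderiv, hs _ (by simp [hi]), zero_mul, zero_mul, neg_zero]
    rw [coeff_add, coeff_add, hv 0 (by decide), hv 1 (by decide), coeff_X_mul_pderiv,
      coeff_X_mul_pderiv, coeff_add, coeff_X_mul_pderiv, coeff_X_mul_pderiv] at h2
    linear_combination h2
  -- Descent in the last exponent from above `l`, where homogeneity applies. The factor (s 0 + s 1)²
  -- vanishes only at powers of the last variable, which `h0` and homogeneity settle.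
  have key : ∀ k : ℕ, ∀ s : Fin 3 →₀ ℕ, l < s 2 + k → coeff s p = 0 := by
    intro k
    induction k with
    | zero => exact fun s hs => Harmonics.coeff_eq_zero hp (by omega)
    | succ k ih =>
      intro s hs
      have h1 := hc s fun t ht => ih t (by omega)
      rcases mul_eq_zero.1 h1 with h2 | h2
      · have h3 : s 0 + s 1 = 0 := by exact_mod_cast pow_eq_zero_iff two_ne_zero |>.1 h2
        by_cases h4 : s 2 = l
        · have : expo 0 0 l = s := expo_ext (by simp; omega) (by simp; omega) (by simp [h4])
          rwa [this] at h0
        · exact Harmonics.coeff_eq_zero hp (by omega)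
      · exact h2
  exact MvPolynomial.ext _ _ fun s => by simpa using key (l + 1) s (by omega)

/-! ### Transitivity on the sphere -/

theorem rotate_frame (x : Ray) (hx : x.moment ≠ 0) (a b : ℝ) :
    rotate (frame x hx) (WithLp.toLp 2 ![a, b, 0]) = a • x.dir + b • ‖x.moment‖⁻¹ • x.moment := by
  ext i
  fin_cases i <;>
    simp [rotate, frame, frameMatrix, Matrix.mulVec, dotProduct, Fin.sum_univ_three] <;> ring

/-- The third basis vector. -/
def axis : E3 := WithLp.toLp 2 ![0, 0, 1]

theorem norm_axis : ‖axis‖ = 1 := by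
  rw [norm_eq_one_iff]
  simp [axis]

/-- Any nonzero `m` orthogonal to `d` makes (d, m) a ray off the origin, and the first column of its
frame is `d`. -/
theorem exists_rotate_first (d : E3) (hd : ‖d‖ = 1) :
    ∃ R : SO3, rotate R (WithLp.toLp 2 ![1, 0, 0]) = d := by
  obtain ⟨m, hm, hdm⟩ : ∃ m : E3, m ≠ 0 ∧ inner ℝ d m = 0 := by
    by_cases h : d 0 = 0 ∧ d 1 = 0
    · refine ⟨WithLp.toLp 2 ![1, 0, 0], fun h0 => ?_, ?_⟩
      · simpa using congrFun (congrArg WithLp.ofLp h0) 0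
      · rw [inner_eq]; simp [h.1]
    · refine ⟨WithLp.toLp 2 ![-d 1, d 0, 0], fun h0 => h ⟨?_, ?_⟩, ?_⟩
      · simpa using congrFun (congrArg WithLp.ofLp h0) 1
      · simpa using congrFun (congrArg WithLp.ofLp h0) 0
      · rw [inner_eq]; simp; ring
  let x : Ray := ⟨(d, m), hd, hdm⟩
  have hx : x.moment ≠ 0 := hm
  refine ⟨frame x hx, ?_⟩
  rw [rotate_frame, one_smul, zero_smul, add_zero]
  rfl

theorem exists_rotate_axis (d : E3) (hd : ‖d‖ = 1) : ∃ R : SO3, rotate R axis = d := by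
  obtain ⟨R, hR⟩ := exists_rotate_first d hd
  obtain ⟨S, hS⟩ := exists_rotate_first axis norm_axis
  refine ⟨R * S⁻¹, ?_⟩
  rw [rotate_mul, ← hS, rotate_inv_rotate, hR]

/-! ### Evaluation functionals -/

/-- Evaluation of harmonic polynomials at a point. -/
def evalH (l : ℕ) (v : E3) : Module.Dual ℝ (Harmonics l) where
  toFun p := MvPolynomial.eval v.ofLp p.1
  map_add' p q := by simp
  map_smul' a p := by simp [MvPolynomial.smul_eval]

theorem evalH_apply (l : ℕ) (v : E3) (p : Harmonics l) :
    evalH l v p = MvPolynomial.eval v.ofLp p.1 := rfl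

theorem evalH_compRotH (l : ℕ) (R : SO3) (v : E3) (p : Harmonics l) :
    evalH l v (compRotH l R p) = evalH l (rotate R v) p :=
  eval_compRot R p.1 v

theorem evalH_smul (l : ℕ) (r : ℝ) (v : E3) (p : Harmonics l) :
    evalH l (r • v) p = r ^ l * evalH l v p := by
  have h : p.1.IsHomogeneous l := p.2.1
  rw [evalH_apply, evalH_apply, MvPolynomial.eval_eq', MvPolynomial.eval_eq', Finset.mul_sum]
  refine Finset.sum_congr rfl fun s hs => ?_
  have hd : s.degree = l := by
    by_contra hne
    exact MvPolynomial.mem_support_iff.1 hs (h.coeff_eq_zero hne)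
  rw [degree_fin_three] at hd
  simp only [Fin.prod_univ_three, PiLp.smul_apply, smul_eq_mul, mul_pow, ← hd, pow_add]
  ring

theorem eq_zero_of_evalH {l : ℕ} {p : Harmonics l} (h : ∀ v : E3, ‖v‖ = 1 → evalH l v p = 0) :
    p = 0 := by
  refine Subtype.ext (MvPolynomial.funext fun w => ?_)
  change evalH l (WithLp.toLp 2 w) p = MvPolynomial.eval w 0
  rw [map_zero]
  set v : E3 := WithLp.toLp 2 w
  by_cases hv : v = 0
  -- For `l = 0` the factor 0 ^ l is 1, so it is the value at the axis that makes the product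
  -- vanish.
  · rw [hv, ← zero_smul ℝ axis, evalH_smul, h _ norm_axis, mul_zero]
  · have : v = ‖v‖ • ‖v‖⁻¹ • v := by
      rw [smul_smul, mul_inv_cancel₀ (norm_ne_zero_iff.2 hv), one_smul]
    rw [this, evalH_smul, h (‖v‖⁻¹ • v) (by simp [norm_smul, hv]), mul_zero]

theorem span_evalH (l : ℕ) : Submodule.span ℝ (Set.range (evalH l)) = ⊤ := by
  have h : (Submodule.span ℝ (Set.range (evalH l))).dualCoannihilator = ⊥ := by
    refine (Submodule.eq_bot_iff _).2 fun p hp => eq_zero_of_evalH fun v _ => ?_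
    exact (Submodule.mem_dualCoannihilator p).1 hp _ (Submodule.subset_span ⟨v, rfl⟩)
  rw [← Subspace.dualCoannihilator_dualAnnihilator_eq
    (W := Submodule.span ℝ (Set.range (evalH l))), h, Submodule.dualAnnihilator_bot]

theorem evalH_axis (l : ℕ) (p : Harmonics l) : evalH l axis p = p.1.coeff (expo 0 0 l) := by
  rw [evalH_apply, MvPolynomial.eval_eq', Finset.sum_eq_single (expo 0 0 l)]
  · simp [Fin.prod_univ_three, axis]
  · intro s hs hne
    by_cases h : s 0 = 0 ∧ s 1 = 0
    · refine absurd (Harmonics.coeff_eq_zero p.2 fun hl => hne ?_)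
        (MvPolynomial.mem_support_iff.1 hs)
      exact expo_ext (by simp [h.1]) (by simp [h.2]) (by simp; omega)
    · rcases not_and_or.1 h with h | h <;> simp [Fin.prod_univ_three, axis, h]
  · intro h
    rw [MvPolynomial.notMem_support_iff.1 h, zero_mul]

theorem evalH_axis_infRotH (l : ℕ) (p : Harmonics l) : evalH l axis (infRotH l p) = 0 := by
  change MvPolynomial.eval axis.ofLp (infRot p.1) = 0
  simp [infRot_apply, axis]

theorem eq_zero_of_infRotH {l : ℕ} {p : Harmonics l} (h : infRotH l p = 0)
    (h0 : evalH l axis p = 0) : p = 0 :=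
  Subtype.ext (eq_zero_of_infRot_eq_zero p.2 (congrArg Subtype.val h) (by rwa [← evalH_axis]))

/-! ### Rotations about the third axis -/

/-- The rotation about the third axis. -/
def rotAxis (θ : ℝ) : SO3 :=
  ⟨!![Real.cos θ, -Real.sin θ, 0; Real.sin θ, Real.cos θ, 0; 0, 0, 1], by
    refine Matrix.mem_specialOrthogonalGroup_iff.2
      ⟨(Matrix.mem_orthogonalGroup_iff' (Fin 3) ℝ).2 ?_, ?_⟩
    · change (_)ᵀ * _ = (1 : Matrix (Fin 3) (Fin 3) ℝ)
      ext i j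
      fin_cases i <;> fin_cases j <;> simp [Matrix.mul_apply, Fin.sum_univ_three] <;>
        nlinarith [Real.sin_sq_add_cos_sq θ]
    · rw [Matrix.det_fin_three]
      simp
      nlinarith [Real.sin_sq_add_cos_sq θ]⟩

theorem rotate_rotAxis (θ : ℝ) (v : E3) : rotate (rotAxis θ) v =
    WithLp.toLp 2 ![Real.cos θ * v 0 - Real.sin θ * v 1, Real.sin θ * v 0 + Real.cos θ * v 1,
      v 2] := by
  ext i
  fin_cases i <;>
    simp [rotate, rotAxis, dotProduct, Fin.sum_univ_three]
  ring

theorem rotate_rotAxis_axis (θ : ℝ) : rotate (rotAxis θ) axis = axis := by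
  rw [rotate_rotAxis]
  simp [axis]

theorem rotate_rotAxis_zero (v : E3) : rotate (rotAxis 0) v = v := by
  rw [rotate_rotAxis]
  ext i
  fin_cases i <;> simp

/-- Both sides obey the Leibniz rule in `p`, so the variables decide. -/
theorem hasDerivAt_eval_rotAxis (p : MvPolynomial (Fin 3) ℝ) (v : E3) :
    HasDerivAt (fun θ => MvPolynomial.eval (rotate (rotAxis θ) v).ofLp p)
      (MvPolynomial.eval v.ofLp (infRot p)) 0 := by
  induction p using MvPolynomial.induction_on with
  | C a => simpa [infRot_apply] using hasDerivAt_const (0 : ℝ) a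
  | add p q hp hq => simpa using hp.fun_add hq
  | mul_X p i hp =>
    have hX : HasDerivAt (fun θ => (rotate (rotAxis θ) v).ofLp i)
        (MvPolynomial.eval v.ofLp (infRot (MvPolynomial.X i))) 0 := by
      have hs := Real.hasDerivAt_sin 0
      have hc := Real.hasDerivAt_cos 0
      simp only [rotate_rotAxis]
      fin_cases i
      · simpa [infRot_apply, MvPolynomial.pderiv_X, Pi.single_apply] using
          (hc.mul_const (v 0)).fun_sub (hs.mul_const (v 1))
      · simpa [infRot_apply, MvPolynomial.pderiv_X, Pi.single_apply] using
          (hs.mul_const (v 0)).fun_add (hc.mul_const (v 1))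
      · simpa [infRot_apply, MvPolynomial.pderiv_X, Pi.single_apply] using
          hasDerivAt_const (0 : ℝ) (v 2)
    have hL : infRot (p * MvPolynomial.X i) = infRot p * MvPolynomial.X i
        + p * infRot (MvPolynomial.X i) := by
      simp only [infRot_apply, MvPolynomial.pderiv_mul]
      ring
    have := hp.fun_mul hX
    rw [rotate_rotAxis_zero] at this
    rw [hL]
    simpa using this

/-- Evaluations span the dual, which reduces the claim to pointwise derivatives. -/
theorem hasDerivAt_dual_rotAxis {l : ℕ} (φ : Module.Dual ℝ (Harmonics l)) (p : Harmonics l) :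
    HasDerivAt (fun θ => φ (compRotH l (rotAxis θ) p)) (φ (infRotH l p)) 0 := by
  have hφ : φ ∈ Submodule.span ℝ (Set.range (evalH l)) := by rw [span_evalH]; trivial
  induction hφ using Submodule.span_induction with
  | mem φ h =>
    obtain ⟨v, rfl⟩ := h
    simp only [evalH_compRotH]
    exact hasDerivAt_eval_rotAxis p.1 v
  | zero => simpa using hasDerivAt_const (0 : ℝ) (0 : ℝ)
  | add φ ψ _ _ h1 h2 => simpa using h1.fun_add h2
  | smul a φ _ h => simpa using h.const_mul a

/-! ### Invariant functionals and invariant subspaces -/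

/-- Otherwise invariance and transitivity on the sphere would make every element of `U` vanish
everywhere. -/
theorem exists_evalH_axis_ne_zero {l : ℕ} {U : Submodule ℝ (Harmonics l)}
    (hU : ∀ R, ∀ p ∈ U, compRotH l R p ∈ U) (hne : U ≠ ⊥) : ∃ p ∈ U, evalH l axis p ≠ 0 := by
  obtain ⟨p, hp, hp0⟩ := Submodule.exists_mem_ne_zero_of_ne_bot hne
  by_contra! h
  refine hp0 (eq_zero_of_evalH fun v hv => ?_)
  obtain ⟨R, rfl⟩ := exists_rotate_axis v hv
  rw [← evalH_compRotH]
  exact h _ (hU R p hp)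

/-- A functional annihilating `U` vanishes along the rotated copies of `p`, hence on their
derivative, and `U` is the common kernel of such functionals. -/
theorem infRotH_mem_of_invariant {l : ℕ} {U : Submodule ℝ (Harmonics l)}
    (hU : ∀ R, ∀ p ∈ U, compRotH l R p ∈ U) {p : Harmonics l} (hp : p ∈ U) :
    infRotH l p ∈ U := by
  rw [← Subspace.dualAnnihilator_dualCoannihilator_eq (W := U), Submodule.mem_dualCoannihilator]
  intro φ hφ
  have h := hasDerivAt_dual_rotAxis φ p
  have h0 : (fun θ => φ (compRotH l (rotAxis θ) p)) = fun _ => 0 :=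
    funext fun θ => (Submodule.mem_dualAnnihilator φ).1 hφ _ (hU _ p hp)
  rw [h0] at h
  exact h.unique (hasDerivAt_const _ _)

/-- The functionals invariant under rotations about the third axis are the multiples of the
evaluation on this axis. -/
theorem exists_eq_smul_evalH_axis {l : ℕ} {φ : Module.Dual ℝ (Harmonics l)}
    (hφ : ∀ R : SO3, rotate R axis = axis → ∀ p, φ (compRotH l R p) = φ p) :
    ∃ c : ℝ, φ = c • evalH l axis := by
  have hL : ∀ p, φ (infRotH l p) = 0 := by
    intro p
    have h := hasDerivAt_dual_rotAxis φ p
    simp only [fun θ => hφ _ (rotate_rotAxis_axis θ) p] at h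
    exact h.unique (hasDerivAt_const _ _)
  -- The infinitesimal rotation maps the finite-dimensional `K` injectively into itself, hence onto
  -- itself, so `φ` vanishes on `K`.
  set K := LinearMap.ker (evalH l axis)
  have hK : ∀ p ∈ K, infRotH l p ∈ K := fun p _ => evalH_axis_infRotH l p
  have hinj : Set.InjOn (infRotH l) K := fun p hp q hq hpq => sub_eq_zero.1 <|
    eq_zero_of_infRotH (by rw [map_sub, hpq, sub_self]) (K.sub_mem hp hq)
  have hφK : ∀ p ∈ K, φ p = 0 := by
    intro p hp
    obtain ⟨q, -, rfl⟩ := (LinearMap.injOn_iff_surjOn hK).1 hinj hp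
    exact hL q
  have hne : (⊤ : Submodule ℝ (Harmonics l)) ≠ ⊥ := by
    have : Nontrivial (Harmonics l) :=
      Module.nontrivial_of_finrank_pos (R := ℝ) (by rw [finrank_harmonics]; omega)
    exact top_ne_bot
  obtain ⟨p₀, -, h₀⟩ := exists_evalH_axis_ne_zero (U := ⊤) (fun _ _ _ => trivial) hne
  refine ⟨φ p₀ / evalH l axis p₀, LinearMap.ext fun p => ?_⟩
  have h := hφK (p - (evalH l axis p / evalH l axis p₀) • p₀) (by
    change evalH l axis _ = 0
    rw [map_sub, map_smul, smul_eq_mul, div_mul_cancel₀ _ h₀, sub_self])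
  rw [map_sub, map_smul, smul_eq_mul, sub_eq_zero] at h
  rw [h, LinearMap.smul_apply, smul_eq_mul]
  ring

/-! ### Irreducibility of the space of harmonic polynomials -/

theorem exists_infRotH_eq_zero {l : ℕ} {U : Submodule ℝ (Harmonics l)}
    (hU : ∀ R, ∀ p ∈ U, compRotH l R p ∈ U) (hne : U ≠ ⊥) :
    ∃ p ∈ U, p ≠ 0 ∧ infRotH l p = 0 := by
  obtain ⟨p₀, hp₀, h₀⟩ := exists_evalH_axis_ne_zero hU hne
  by_contra! h
  -- If injective on `U`, the infinitesimal rotation would be onto `U` and reach `p₀`, but its image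
  -- vanishes at the axis.
  have hinj : Set.InjOn (infRotH l) U := by
    intro p hp q hq hpq
    by_contra hne
    exact h (p - q) (U.sub_mem hp hq) (sub_ne_zero.2 hne) (by rw [map_sub, hpq, sub_self])
  obtain ⟨q, -, rfl⟩ := (LinearMap.injOn_iff_surjOn
    fun p hp => infRotH_mem_of_invariant hU hp).1 hinj hp₀
  exact h₀ (evalH_axis_infRotH l q)

theorem continuous_evalH {l : ℕ} (p : Harmonics l) : Continuous fun v => evalH l v p :=
  (MvPolynomial.continuous_eval p.1).comp (PiLp.continuous_ofLp 2 _)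

theorem integrable_evalH_mul {l : ℕ} (p q : Harmonics l) :
    Integrable (fun d : Metric.sphere (0 : E3) 1 => evalH l d.1 p * evalH l d.1 q)
      (volume : Measure E3).toSphere := by
  refine Continuous.integrable_of_hasCompactSupport ?_ (HasCompactSupport.of_compactSpace _)
  exact ((continuous_evalH p).comp continuous_subtype_val).mul
    ((continuous_evalH q).comp continuous_subtype_val)

/-- The inner product of spherical harmonics. -/
def harmonicInner (l : ℕ) : Harmonics l →ₗ[ℝ] Module.Dual ℝ (Harmonics l) :=
  LinearMap.mk₂ ℝ (fun p q => ∫ d : Metric.sphere (0 : E3) 1, evalH l d.1 p * evalH l d.1 q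
      ∂(volume : Measure E3).toSphere)
    (fun p q r => by
      simp only [map_add, add_mul]
      exact integral_add (integrable_evalH_mul _ _) (integrable_evalH_mul _ _))
    (fun a p q => by
      simp only [map_smul, smul_eq_mul, mul_assoc]
      exact integral_const_mul _ _)
    (fun p q r => by
      simp only [map_add, mul_add]
      exact integral_add (integrable_evalH_mul _ _) (integrable_evalH_mul _ _))
    (fun a p q => by
      simp only [map_smul, smul_eq_mul, mul_left_comm _ a]
      exact integral_const_mul _ _)

theorem harmonicInner_apply {l : ℕ} (p q : Harmonics l) : harmonicInner l p q =
    ∫ d : Metric.sphere (0 : E3) 1, evalH l d.1 p * evalH l d.1 q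
      ∂(volume : Measure E3).toSphere := rfl

theorem harmonicInner_compRotH {l : ℕ} (R : SO3) (p q : Harmonics l) :
    harmonicInner l (compRotH l R p) (compRotH l R q) = harmonicInner l p q := by
  have hemb : MeasurableEmbedding (rotateSphere R) := by
    refine (continuous_rotateSphere R).measurableEmbedding fun d e h => Subtype.ext ?_
    exact (rotateIso R).injective (congrArg Subtype.val h)
  rw [harmonicInner_apply, harmonicInner_apply,
    ← (measurePreserving_rotateSphere R).integral_comp hemb
      (fun d => evalH l d.1 p * evalH l d.1 q)]
  refine integral_congr_ae (Filter.Eventually.of_forall fun d => ?_)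
  simp only [evalH_compRotH]
  rfl

theorem eq_zero_of_harmonicInner_self {l : ℕ} {p : Harmonics l} (h : harmonicInner l p p = 0) :
    p = 0 := by
  rw [harmonicInner_apply, integral_eq_zero_iff_of_nonneg (fun d => mul_self_nonneg _)
    (integrable_evalH_mul p p)] at h
  have hc : Continuous fun d : Metric.sphere (0 : E3) 1 => evalH l d.1 p :=
    (continuous_evalH p).comp continuous_subtype_val
  have h' := (Continuous.ae_eq_iff_eq _ (hc.mul hc) continuous_const).1 h
  refine eq_zero_of_evalH fun v hv => ?_
  exact mul_self_eq_zero.1 (congrFun h' ⟨v, by simp [hv]⟩)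

theorem eq_bot_or_eq_top_of_invariant {l : ℕ} {U : Submodule ℝ (Harmonics l)}
    (hU : ∀ R, ∀ p ∈ U, compRotH l R p ∈ U) : U = ⊥ ∨ U = ⊤ := by
  by_contra! hcon
  obtain ⟨z, hzU, hz0, hzL⟩ := exists_infRotH_eq_zero hU hcon.1
  obtain ⟨φ, hφ0, hφ⟩ := Submodule.exists_dual_map_eq_bot_of_lt_top hcon.2.lt_top inferInstance
  have hinj : Function.Injective (harmonicInner l) := by
    refine (injective_iff_map_eq_zero _).2 fun p hp => eq_zero_of_harmonicInner_self ?_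
    rw [hp]; rfl
  -- A definite form represents every functional, so a functional killing the proper subspace `U`
  -- yields a nonzero `q` orthogonal to `U`.
  obtain ⟨q, rfl⟩ := (LinearMap.injective_iff_surjective_of_finrank_eq_finrank
    (Subspace.dual_finrank_eq (K := ℝ) (V := Harmonics l)).symm).1 hinj φ
  let U' : Submodule ℝ (Harmonics l) := ⨅ p ∈ U, LinearMap.ker ((harmonicInner l).flip p)
  have hU' : ∀ r, r ∈ U' ↔ ∀ p ∈ U, harmonicInner l r p = 0 := by
    intro r
    simp [U', Submodule.mem_iInf]
  have hqU' : q ∈ U' := (hU' q).2 fun p hp => by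
    have := Submodule.mem_map_of_mem (f := harmonicInner l q) hp
    rwa [hφ, Submodule.mem_bot] at this
  have hne : U' ≠ ⊥ := fun h => by
    rw [h, Submodule.mem_bot] at hqU'
    exact hφ0 (by rw [hqU', map_zero])
  have hinv : ∀ R, ∀ p ∈ U', compRotH l R p ∈ U' := by
    intro R p hp
    refine (hU' _).2 fun u hu => ?_
    rw [← (hU' p).1 hp _ (hU R⁻¹ u hu), ← harmonicInner_compRotH R p]
    congr 1
    refine Subtype.ext ?_
    change u.1 = compRot R (compRot R⁻¹ u.1)
    rw [← compRot_mul, inv_mul_cancel, compRot_one]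
  obtain ⟨w, hwU', hw0, hwL⟩ := exists_infRotH_eq_zero hinv hne
  have hze : evalH l axis z ≠ 0 := fun h => hz0 (eq_zero_of_infRotH hzL h)
  -- Axially invariant harmonics form a line, so `w` also lies in `U` and is orthogonal to itself.
  have hw : w = (evalH l axis w / evalH l axis z) • z := by
    rw [← sub_eq_zero]
    refine eq_zero_of_infRotH ?_ ?_
    · rw [map_sub, map_smul, hwL, hzL, smul_zero, sub_zero]
    · rw [map_sub, map_smul, smul_eq_mul, div_mul_cancel₀ _ hze, sub_self]
  refine hw0 (eq_zero_of_harmonicInner_self ((hU' w).1 hwU' w ?_))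
  rw [hw]
  exact U.smul_mem _ hzU

/-! ### The representation of type `l` -/

/-- The Wigner matrix is the transpose of the action on polynomials, so reading `v` as the
functional with values v_i on Y_i turns `wigner` into the dual action. -/
theorem constr_wigner {l : ℕ} (Y : Module.Basis (Fin (2 * l + 1)) ℝ (Harmonics l)) (R : SO3)
    (v : Fin (2 * l + 1) → ℝ) (p : Harmonics l) :
    Y.constr ℝ (wigner Y R v) p = Y.constr ℝ v (compRotH l R p) := by
  have : Y.constr ℝ (wigner Y R v) = Y.constr ℝ v ∘ₗ compRotH l R := by
    refine Y.ext fun i => ?_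
    rw [Module.Basis.constr_basis, LinearMap.comp_apply, Module.Basis.constr_apply_fintype]
    simp [wigner, Matrix.mulVec, dotProduct, LinearMap.toMatrix_apply]
  rw [this, LinearMap.comp_apply]

theorem constr_sphHarm {l : ℕ} (Y : Module.Basis (Fin (2 * l + 1)) ℝ (Harmonics l)) (d : E3) :
    Y.constr ℝ (sphHarm Y d) = evalH l d :=
  Y.constr_eq ℝ fun _ => rfl

/-- The polynomials annihilated by a subrepresentation form an invariant subspace, hence zero or
everything; double annihilators carry this back. -/
theorem wigner_isIrreducible {l : ℕ} (Y : Module.Basis (Fin (2 * l + 1)) ℝ (Harmonics l)) :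
    (wigner Y).IsIrreducible := by
  have hnt : Nontrivial (Subrepresentation (wigner Y)) := by
    refine ⟨⟨⊥, ⊤, fun h => ?_⟩⟩
    have h' : (⊥ : Submodule ℝ (Fin (2 * l + 1) → ℝ)) = ⊤ :=
      congrArg Subrepresentation.toSubmodule h
    exact bot_ne_top h'
  refine { eq_bot_or_eq_top := fun σ => ?_ }
  set D : Submodule ℝ (Module.Dual ℝ (Harmonics l)) :=
    σ.toSubmodule.map (Y.constr ℝ).toLinearMap with hD
  have hinv : ∀ R, ∀ p ∈ D.dualCoannihilator, compRotH l R p ∈ D.dualCoannihilator := by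
    intro R p hp
    rw [Submodule.mem_dualCoannihilator] at hp ⊢
    rintro _ ⟨v, hv, rfl⟩
    exact (constr_wigner Y R v p).symm.trans
      (hp _ ⟨_, σ.apply_mem_toSubmodule R hv, rfl⟩)
  have hDD := Subspace.dualCoannihilator_dualAnnihilator_eq (W := D)
  rcases eq_bot_or_eq_top_of_invariant hinv with h | h
  · right
    rw [h, Submodule.dualAnnihilator_bot] at hDD
    refine Subrepresentation.toSubmodule_injective ?_
    exact Submodule.map_injective_of_injective (Y.constr ℝ).injective
      (hDD.symm.trans (by
        change ⊤ = Submodule.map _ (⊤ : Submodule ℝ (Fin (2 * l + 1) → ℝ))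
        rw [Submodule.map_top, LinearEquiv.range]))
  · left
    rw [h, Submodule.dualAnnihilator_top] at hDD
    refine Subrepresentation.toSubmodule_injective ?_
    exact Submodule.map_injective_of_injective (Y.constr ℝ).injective
      (hDD.symm.trans (Submodule.map_bot _).symm)

theorem exists_eq_smul_sphHarm_axis {l : ℕ}
    (Y : Module.Basis (Fin (2 * l + 1)) ℝ (Harmonics l)) {v : Fin (2 * l + 1) → ℝ}
    (hv : ∀ R : SO3, rotate R axis = axis → wigner Y R v = v) :
    ∃ c : ℝ, v = c • sphHarm Y axis := by
  obtain ⟨c, hc⟩ := exists_eq_smul_evalH_axis (φ := Y.constr ℝ v) fun R hR p => by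
    rw [← constr_wigner, hv R hR]
  refine ⟨c, (Y.constr ℝ).injective ?_⟩
  rw [map_smul, constr_sphHarm]
  exact hc

/-! ### The solutions of the kernel constraint -/

/-- The ray through the origin with direction `d`. -/
def centralRay (d : E3) (hd : ‖d‖ = 1) : Ray := ⟨(d, 0), hd, inner_zero_right _⟩

/-- A standard ray at signed distance `r` from the origin. -/
def standardRay (r : ℝ) : Ray :=
  ⟨(WithLp.toLp 2 ![1, 0, 0], WithLp.toLp 2 ![0, r, 0]), by
    refine ⟨?_, ?_⟩
    · rw [norm_eq_one_iff]; simp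
    · rw [inner_eq]; simp⟩

theorem ofRot_smul_centralRay (R : SO3) (d : E3) (hd : ‖d‖ = 1) :
    ofRot R • centralRay d hd = centralRay (rotate R d) (by rw [norm_rotate, hd]) :=
  Ray.ext rfl ((moment_ofRot_smul R _).trans (rotate_zero R))

theorem frame_smul_standardRay (x : Ray) (hx : x.moment ≠ 0) :
    ofRot (frame x hx) • standardRay ‖x.moment‖ = x := by
  refine Ray.ext ?_ ?_
  · have := rotate_frame x hx 1 0
    rw [one_smul, zero_smul, add_zero] at this
    exact this
  · have := rotate_frame x hx 0 ‖x.moment‖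
    rw [zero_smul, zero_add, smul_smul, mul_inv_cancel₀ (norm_ne_zero_iff.2 hx), one_smul] at this
    rw [moment_ofRot_smul]
    exact this

theorem frame_ofRot_smul (R : SO3) (x : Ray) (hx : x.moment ≠ 0)
    (hx' : (ofRot R • x).moment ≠ 0) : frame (ofRot R • x) hx' = R * frame x hx := by
  refine Subtype.ext ?_
  change frameMatrix (ofRot R • x) = R.1 * frameMatrix x
  have h1 : (ofRot R • x).dir = rotate R x.dir := rfl
  have h2 : ‖(ofRot R • x).moment‖⁻¹ • (ofRot R • x).moment
      = rotate R (‖x.moment‖⁻¹ • x.moment) := by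
    rw [moment_ofRot_smul, norm_rotate, rotate_smul]
  rw [frameMatrix, frameMatrix, h2, h1, ← rotate_cross]
  ext i j
  fin_cases j <;> simp [rotate, Matrix.mul_apply, Matrix.mulVec, dotProduct]

theorem kernelConstraint_iff {l : ℕ} (Y : Module.Basis (Fin (2 * l + 1)) ℝ (Harmonics l))
    (κ : Ray → Fin (2 * l + 1) → ℝ) :
    KernelConstraint (wigner Y) κ ↔
      ∃ (c : ℝ) (f : ℝ → Fin (2 * l + 1) → ℝ), ∀ x : Ray,
        (x.moment = 0 → κ x = c • sphHarm Y x.dir) ∧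
        (∀ hx : x.moment ≠ 0, κ x = wigner Y (frame x hx) (f ‖x.moment‖)) := by
  constructor
  · intro h
    -- A rotation fixing the axis fixes the central ray along it, so the constraint makes the value
    -- of `κ` there a fixed vector.
    obtain ⟨c, hc⟩ := exists_eq_smul_sphHarm_axis Y (v := κ (centralRay axis norm_axis))
      fun R hR => by
        rw [← h, ofRot_smul_centralRay]
        congr 1
        exact Ray.ext hR rfl
    refine ⟨c, fun r => κ (standardRay r), fun x => ⟨fun hx => ?_, fun hx => ?_⟩⟩
    · obtain ⟨R, hR⟩ := exists_rotate_axis x.dir x.norm_dir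
      have hxR : x = ofRot R • centralRay axis norm_axis := by
        rw [ofRot_smul_centralRay]
        exact Ray.ext hR.symm hx
      rw [← hR, sphHarm_rotate, ← map_smul, ← hc, ← h, ← hxR]
    · rw [← h, frame_smul_standardRay]
  · rintro ⟨c, f, h⟩ R x
    by_cases hx : x.moment = 0
    · have hx' : (ofRot R • x).moment = 0 := by rw [moment_ofRot_smul, hx, rotate_zero]
      rw [(h _).1 hx', (h _).1 hx, map_smul, ← sphHarm_rotate]
      rfl
    · have hx' : (ofRot R • x).moment ≠ 0 := by
        rw [moment_ofRot_smul]
        exact fun h0 => hx (norm_eq_zero.1 (by rw [← norm_rotate R, h0, norm_zero]))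
      rw [(h _).2 hx', (h _).2 hx, frame_ofRot_smul R x hx hx', map_mul, moment_ofRot_smul,
        norm_rotate]
      rfl

end RayConv

end

open RayConv in
theorem mainTheorem3 (l : ℕ) :
    Module.finrank ℝ (Harmonics l) = 2 * l + 1 ∧
    ∀ Y : Module.Basis (Fin (2 * l + 1)) ℝ (Harmonics l),
      (wigner Y).IsIrreducible ∧
      -- the convolution is equivariant iff the kernel satisfies the constraint
      (∀ κ : Ray → Fin (2 * l + 1) → ℝ, MeasureTheory.LocallyIntegrable κ rayMeasure →
        (ConvEquivariant (wigner Y) (fun _ => rayMeasure) κ ↔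
          ∀ R : SO3, ∀ᵐ x ∂rayMeasure, κ (ofRot R • x) = wigner Y R (κ x))) ∧
      (∀ κ : Ray → Fin (2 * l + 1) → ℝ, Continuous κ →
        (ConvEquivariant (wigner Y) (fun _ => rayMeasure) κ ↔ KernelConstraint (wigner Y) κ)) ∧
      -- the solutions of the constraint
      (∀ κ : Ray → Fin (2 * l + 1) → ℝ,
        KernelConstraint (wigner Y) κ ↔
          ∃ (c : ℝ) (f : ℝ → Fin (2 * l + 1) → ℝ), ∀ x : Ray,
            (x.moment = 0 → κ x = c • sphHarm Y x.dir) ∧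
            (∀ hx : x.moment ≠ 0, κ x = wigner Y (frame x hx) (f ‖x.moment‖))) ∧
      -- local support
      (∀ κ : Ray → Fin (2 * l + 1) → ℝ, KernelConstraint (wigner Y) κ →
        ∀ d₀ : ℝ, KernelConstraint (wigner Y) (truncate d₀ κ)) ∧
      -- the case of rays through the point
      (∀ (κ : Ray → Fin (2 * l + 1) → ℝ) (c : ℝ),
        (∀ x : Ray, x.moment = 0 → κ x = c • sphHarm Y x.dir) →
        ∀ (f : Ray → ℝ) (x : E3),
          conv pencilMeasure (truncate 0 κ) f x
            = c • conv pencilMeasure (fun y => sphHarm Y y.dir) f x) ∧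
      ConvEquivariant (wigner Y) pencilMeasure (fun y => sphHarm Y y.dir) := by
  refine ⟨finrank_harmonics l, fun Y => ⟨wigner_isIrreducible Y,
    fun κ hκ => convEquivariant_rayMeasure_iff (wigner Y) hκ,
    fun κ hκ => convEquivariant_rayMeasure_iff_of_continuous (wigner Y) hκ,
    kernelConstraint_iff Y, fun κ hκ d₀ => hκ.truncate d₀,
    fun κ c hκ f x => conv_truncate_zero hκ f x,
    convEquivariant_of_ae map_smul_pencilMeasure fun R x => ?_⟩⟩
  exact Filter.Eventually.of_forall fun y => sphHarm_rotate Y R _
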